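/- Let $K$ be a (strict) 2-category and let $T=(T,\mu,\eta)$ be a 2-monad on $K$, that is, a 2-functor $T\colon K\to K$ with 2-natural transformations $\mu\colon T^2\to T$, $\eta\colon 1\to T$ satisfying the associativity and unit laws strictly. Notation: * A $T$-algebra is a pair $(X,\,x\colon TX\to X)$ with $x\circ\eta_X=1_X$ and $x\circ Tx=x\circ\mu_X$; the free algebra on $C\in K$ is $(TC,\mu_C)$. A $T$-map (pseudomorphism) $f\colon(X,x)\rightsquigarrow(Y,y)$ is a 1-cell $f\colon X\to Y$ with an invertible 2-cell $f_\bullet\colon y\circ Tf\cong f\circ x$ such that $f_\bullet*\eta_X=1_f$ and $(f_\bullet * Tx)\circ(y* Tf_\bullet)=f_\bullet*\mu_X$; it is strict if $f_\bullet$ is an identity. A $T$-algebra 2-cell $\alpha\colon f\to g$ is a 2-cell of $K$ with $g_\bullet\circ(y*T\alpha)=(\alpha*x)\circ f_\bullet$. $T\text{-}\mathsf{Alg}$, respectively $T\text{-}\mathsf{Alg}_s$, is the 2-category of $T$-algebras, $T$-maps, respectively strict $T$-maps, and $T$-algebra 2-cells, and $i\colon T\text{-}\mathsf{Alg}_s\to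 T\text{-}\mathsf{Alg}$ is the inclusion 2-functor. * A pseudomorphism classifier for $T$ is a left 2-adjoint $Q\dashv i$; its unit is $\zeta$ and its counit is $\delta$. * $T$ admits universal pseudomorphisms if for each 1-cell $\phi\colon C\to C'$ of $K$ there are a $T$-algebra $T(C',\phi)$, a $T$-map $\widetilde\phi\colon TC\rightsquigarrow T(C',\phi)$ and a 1-cell $\kappa_\phi\colon C'\to T(C',\phi)$ in $K$ with $\widetilde\phi\circ\eta_C=\kappa_\phi\circ\phi$, such that for every $T$-map $f\colon X\rightsquigarrow X'$ the assignment $(j,k)\mapsto(j\circ\eta_C,\,k\circ\kappa_\phi)$ is a bijection from the set of pairs of strict $T$-maps $j\colon TC\to X$, $k\colon T(C',\phi)\to X'$ with $f\circ j=k\circ\widetilde\phi$ in $T\text{-}\mathsf{Alg}$ to the set of pairs of 1-cells $R\colon C\to X$, $S\colon C'\to X'$ of $K$ with $f\circ R=S\circ\phi$ in $K$. Then $\Delta\colon T(C',\phi)\to TC'$ denotes the second component of the pair $(j,k)$ corresponding to $(R,S)=(\eta_C,\eta_{C'})$ for $f=T\phi\colon TC\to TC'$. * Given universal pseudomorphisms,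 put $PC=T(C,1_C)$, and for a $T$-map $h\colon TC\rightsquigarrow TC'$ let $Ph\colon PC\to PC'$ be the second component of the pair corresponding to $(R,S)=(\eta_C,\ \widetilde{1_{C'}}\circ h\circ\eta_C)$ for $f=\widetilde{1_{C'}}\circ h$. The $P$-free pair of a $T$-algebra $(X,x)$ is the pair $P\mu_X,\,P(Tx)\colon P(TX)\rightrightarrows PX$. * In a 2-category, a 1-cell $\delta\colon Z\to Y$ is a surjective equivalence if there is $\zeta\colon Y\to Z$ with $\delta\zeta=1_Y$ and $\zeta\delta\cong 1_Z$; $(\zeta,\delta,\Theta)$ is an adjoint surjective equivalence if $\delta\zeta=1_Y$ and $\Theta\colon\zeta\delta\cong1_Z$ is an invertible 2-cell with $\Theta*\zeta=1_\zeta$. **Theorem (Pseudomorphism Coherence).** Suppose that 1. $K$ admits pseudolimits of 1-cells: for each $f\colon A\to B$ there is a universal object $L$ equipped with 1-cells $u\colon L\to A$, $v\colon L\to B$ and an invertible 2-cell $f u\cong v$ (with the one- and two-dimensional universal properties); 2. $K$ admits, for each object $C$, (a) the cotensor $\{\mathbb 2,C\}$ with the free arrow category $\mathbb 2$ and (b)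 the cotensor $\{\mathbb I,C\}$ with the free isomorphism category $\mathbb I$; 3. (the underlying category of) $T\text{-}\mathsf{Alg}_s$ has pushouts; and 4. (the underlying category of) $T\text{-}\mathsf{Alg}_s$ has coequalizers of $P$-free pairs, for all $T$-algebras $(X,x)$, whenever universal pseudomorphisms for $T$, and hence $P$, are given. Then the following are equivalent: * (A) $T$ admits a pseudomorphism classifier $(Q,i,\zeta,\delta)$. * (B) $T$ admits universal pseudomorphisms $\widetilde\phi$. Moreover, in this case, for each $T$-algebra $Y$ and each 1-cell $\phi\colon C\to C'$ in $K$: * (C) for any pseudomorphism classifier, there is an invertible $T$-algebra 2-cell $\Theta\colon\zeta_Y\delta_Y\cong 1_{QY}$ such that $(\zeta_Y,\delta_Y,\Theta)$ is an adjoint surjective equivalence in $T\text{-}\mathsf{Alg}$; * (D) for any choice of universal pseudomorphisms, the strict $T$-map $\Delta\colon T(C',\phi)\to TC'$ is a surjective equivalence in $T\text{-}\mathsf{Alg}_s$. -/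

import Mathlib

open CategoryTheory Bicategory

universe w v u w₁ v₁ u₁ w₂ v₂ u₂

namespace TwoDim

/-! ### General 2-category theory

A 2-category is a bicategory `K` with `Bicategory.Strict K`, and a 2-functor between 2-categories is
a `StrictPseudofunctor`. Composites are written in diagrammatic order. -/

section General

/-- 2-naturality of a family of 1-cells `F X ⟶ G X`, with respect to 1-cells and to 2-cells. -/
structure IsTwoNatural {B : Type u₁} [Bicategory.{w₁, v₁} B] {C : Type u₂} [Bicategory.{w₂, v₂} C]
    (F G : StrictPseudofunctor B C) (app : ∀ X : B, F.obj X ⟶ G.obj X) : Prop where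
  naturality {X Y : B} (f : X ⟶ Y) : F.map f ≫ app Y = app X ≫ G.map f
  naturality₂ {X Y : B} {f g : X ⟶ Y} (θ : f ⟶ g) :
    F.map₂ θ ▷ app Y =
      eqToHom (naturality f) ≫ app X ◁ G.map₂ θ ≫ eqToHom (naturality g).symm

/-- A 2-adjunction `L ⊣ R`, presented by a 2-natural unit and counit satisfying the triangle
identities strictly. -/
structure TwoAdjunction {A : Type u₁} [Bicategory.{w₁, v₁} A] {B : Type u₂}
    [Bicategory.{w₂, v₂} B] (L : StrictPseudofunctor A B) (R : StrictPseudofunctor B A) where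
  unit : ∀ X : A, X ⟶ R.obj (L.obj X)
  counit : ∀ Y : B, L.obj (R.obj Y) ⟶ Y
  unit_natural : IsTwoNatural (StrictPseudofunctor.id A) (L.comp R) unit
  counit_natural : IsTwoNatural (R.comp L) (StrictPseudofunctor.id B) counit
  left_triangle : ∀ X : A, L.map (unit X) ≫ counit (L.obj X) = 𝟙 (L.obj X)
  right_triangle : ∀ Y : B, unit (R.obj Y) ≫ R.map (counit Y) = 𝟙 (R.obj Y)

variable {K : Type u} [Bicategory.{w, v} K] [Bicategory.Strict K]

/-- `δ : Z ⟶ Y` is a surjective equivalence: it has a section `ζ` such that `ζ ∘ δ` is isomorphic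
to the identity. -/
def IsSurjectiveEquivalence {Y Z : K} (δ : Z ⟶ Y) : Prop :=
  ∃ ζ : Y ⟶ Z, ζ ≫ δ = 𝟙 Y ∧ Nonempty (δ ≫ ζ ≅ 𝟙 Z)

/-- `(ζ, δ, Θ)` is an adjoint surjective equivalence: `δ ∘ ζ = 1` and `Θ : ζ ∘ δ ≅ 1` satisfies
`Θ * ζ = 1_ζ`. -/
structure IsAdjointSurjectiveEquivalence {Y Z : K} (ζ : Y ⟶ Z) (δ : Z ⟶ Y) (Θ : δ ≫ ζ ≅ 𝟙 Z) :
    Prop where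
  retraction : ζ ≫ δ = 𝟙 Y
  whisker : ζ ◁ Θ.hom =
    eqToHom (by rw [← Category.assoc, retraction, Category.id_comp, Category.comp_id])

/-- An isomorphism of categories: a fully faithful functor that is bijective on objects. -/
structure IsIsoOfCategories {C : Type u₁} [Category.{v₁} C] {D : Type u₂} [Category.{v₂} D]
    (F : C ⥤ D) : Prop where
  bijective_obj : Function.Bijective F.obj
  full : F.Full
  faithful : F.Faithful

/-- The cotensor `{J, X}`: an object with a universal functor `cone : J ⥤ K({J, X}, X)`, that is,
`g ↦ cone ∘ g` is an isomorphism of categories `K(W, {J, X}) ≅ Cat(J, K(W, X))` for every `W`. -/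
structure Cotensor (J : Type u₁) [Category.{v₁} J] (X : K) where
  obj : K
  cone : J ⥤ (obj ⟶ X)
  universal : ∀ W : K, IsIsoOfCategories
    (precomposing W obj X ⋙ (Functor.whiskeringLeft J (obj ⟶ X) (W ⟶ X)).obj cone)

/-- The pseudolimit of a 1-cell `f : A ⟶ B`: the universal object `L` with projections to `A` and
`B` and an invertible 2-cell `f ∘ fst ≅ snd`, with its one- and two-dimensional universal
properties. -/
structure Pseudolimit {A B : K} (f : A ⟶ B) where
  obj : K
  fst : obj ⟶ A
  snd : obj ⟶ B
  iso : fst ≫ f ≅ snd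
  universal : ∀ {W : K} (a : W ⟶ A) (b : W ⟶ B) (σ : a ≫ f ≅ b),
    ∃! z : W ⟶ obj, ∃ (ha : a = z ≫ fst) (hb : z ≫ snd = b),
      eqToHom (by rw [ha, Category.assoc]) ≫ z ◁ iso.hom ≫ eqToHom hb = σ.hom
  universal₂ : ∀ {W : K} (z z' : W ⟶ obj) (ξ : z ≫ fst ⟶ z' ≫ fst) (χ : z ≫ snd ⟶ z' ≫ snd),
    (α_ z fst f).inv ≫ ξ ▷ f ≫ (α_ z' fst f).hom ≫ z' ◁ iso.hom = z ◁ iso.hom ≫ χ →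
      ∃! ω : z ⟶ z', ω ▷ fst = ξ ∧ ω ▷ snd = χ

end General

/-! ### 2-monads and their algebras -/

/-- A 2-monad `(T, μ, η)` on a 2-category. -/
structure TwoMonad (K : Type u) [Bicategory.{w, v} K] [Bicategory.Strict K] extends
    StrictPseudofunctor K K where
  μ : ∀ X : K, obj (obj X) ⟶ obj X
  η : ∀ X : K, X ⟶ obj X
  μ_natural : IsTwoNatural (toStrictPseudofunctor.comp toStrictPseudofunctor)
    toStrictPseudofunctor μ
  η_natural : IsTwoNatural (StrictPseudofunctor.id K) toStrictPseudofunctor η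
  assoc : ∀ X : K, map (μ X) ≫ μ X = μ (obj X) ≫ μ X
  left_unit : ∀ X : K, η (obj X) ≫ μ X = 𝟙 (obj X)
  right_unit : ∀ X : K, map (η X) ≫ μ X = 𝟙 (obj X)

namespace TwoMonad

variable {K : Type u} [Bicategory.{w, v} K] [Bicategory.Strict K]

theorem η_comm (T : TwoMonad K) {X Y : K} (f : X ⟶ Y) : f ≫ T.η Y = T.η X ≫ T.map f :=
  T.η_natural.naturality f

theorem μ_comm (T : TwoMonad K) {X Y : K} (f : X ⟶ Y) :
    T.map (T.map f) ≫ T.μ Y = T.μ X ≫ T.map f :=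
  T.μ_natural.naturality f

theorem η_comm₂ (T : TwoMonad K) {X Y : K} {f g : X ⟶ Y} (θ : f ⟶ g) :
   θ ▷ T.η Y = eqToHom (T.η_comm f) ≫ T.η X ◁ T.map₂ θ ≫ eqToHom (T.η_comm g).symm :=
  T.η_natural.naturality₂ θ

theorem μ_comm₂ (T : TwoMonad K) {X Y : K} {f g : X ⟶ Y} (θ : f ⟶ g) :
    T.map₂ (T.map₂ θ) ▷ T.μ Y =
      eqToHom (T.μ_comm f) ≫ T.μ X ◁ T.map₂ θ ≫ eqToHom (T.μ_comm g).symm :=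
  T.μ_natural.naturality₂ θ

/-- A (strict) algebra for a 2-monad. -/
structure Alg (T : TwoMonad K) where
  carrier : K
  str : T.obj carrier ⟶ carrier
  unit : T.η carrier ≫ str = 𝟙 carrier
  assoc : T.map str ≫ str = T.μ carrier ≫ str

variable {T : TwoMonad K}

theorem unit_src {X Y : T.Alg} (f : X.carrier ⟶ Y.carrier) :
    T.η X.carrier ≫ T.map f ≫ Y.str = T.η X.carrier ≫ X.str ≫ f := by
  rw [← Category.assoc, ← T.η_comm f, Category.assoc, Y.unit, ← Category.assoc, X.unit,
    Category.comp_id, Category.id_comp]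

theorem mult_mid {X Y : T.Alg} (f : X.carrier ⟶ Y.carrier) :
    T.map (X.str ≫ f) ≫ Y.str = T.map X.str ≫ T.map f ≫ Y.str := by
  rw [T.map_comp, Category.assoc]

theorem mult_src {X Y : T.Alg} (f : X.carrier ⟶ Y.carrier) :
    T.map (T.map f ≫ Y.str) ≫ Y.str = T.μ X.carrier ≫ T.map f ≫ Y.str := by
  rw [T.map_comp, Category.assoc, Y.assoc, ← Category.assoc, T.μ_comm, Category.assoc]

theorem mult_tgt {X Y : T.Alg} (f : X.carrier ⟶ Y.carrier) :
    T.map X.str ≫ X.str ≫ f = T.μ X.carrier ≫ X.str ≫ f := by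
  rw [← Category.assoc, X.assoc, Category.assoc]

/-- A pseudomorphism of algebras: a 1-cell `f` together with an invertible 2-cell
`cst : y ∘ T f ≅ f ∘ x` satisfying the unit and multiplication axioms. -/
structure PseudoHom (X Y : T.Alg) where
  hom : X.carrier ⟶ Y.carrier
  cst : T.map hom ≫ Y.str ≅ X.str ≫ hom
  unit : T.η X.carrier ◁ cst.hom = eqToHom (unit_src hom)
  mult : T.map₂ cst.hom ▷ Y.str ≫ eqToHom (mult_mid hom) ≫ T.map X.str ◁ cst.hom =
    eqToHom (mult_src hom) ≫ T.μ X.carrier ◁ cst.hom ≫ eqToHom (mult_tgt hom).symm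

attribute [local simp] PrelaxFunctor.map₂_eqToHom
  Strict.leftUnitor_eqToIso Strict.rightUnitor_eqToIso Strict.associator_eqToIso

/-- The identity pseudomorphism. -/
@[simps]
abbrev PseudoHom.id (X : T.Alg) : PseudoHom X X where
  hom := 𝟙 X.carrier
  cst := eqToIso (by rw [T.map_id, Category.id_comp, Category.comp_id])
  unit := by simp
  mult := by simp

attribute [local simp] StrictPseudofunctor.mapComp_eq_eqToIso

/-- The composite of pseudomorphisms, with constraint `(g ∘ f)_• = (g * f_•) ∘ (g_• * T f)`. -/
@[simps]
abbrev PseudoHom.comp {X Y Z : T.Alg} (f : PseudoHom X Y) (g : PseudoHom Y Z) : PseudoHom X Z where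
  hom := f.hom ≫ g.hom
  cst := eqToIso (by rw [T.map_comp, Category.assoc]) ≪≫
    whiskerLeftIso (T.map f.hom) g.cst ≪≫ (α_ _ _ _).symm ≪≫ whiskerRightIso f.cst g.hom ≪≫ α_ _ _ _
  unit := by
    have h1 := congr(f.hom ◁ $(g.unit))
    have h2 := congr($(f.unit) ▷ g.hom ≫ (α_ _ _ _).hom)
    have h3 := congr((α_ _ _ _).inv ≫
      $(congr_whiskerLeft (T.η_comm f.hom).symm g.cst.hom) ≫ (α_ _ _ _).hom)
    simp at h1 h2 h3 ⊢
    rw [eqToHom_comp_iff] at h2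
    simp [h2, h3, h1]
  mult := by
    have h1 := congr(T.map (T.map f.hom) ◁ $(g.mult))
    have h2 := congr($(f.mult) ▷ g.hom ≫ (α_ _ _ _).hom)
    have h3 := congr((α_ _ _ _).inv ≫
      $(congr_whiskerLeft (T.μ_comm f.hom) g.cst.hom) ≫ (α_ _ _ _).hom)
    have h4 := (whisker_exchange (T.map₂ f.cst.hom) g.cst.hom).symm
    have h5 := congr((α_ _ _ _).inv ≫
      $(congr_whiskerLeft (T.map_comp X.str f.hom).symm g.cst.hom) ≫ (α_ _ _ _).hom)
    have h6 := congr_whiskerLeft (T.map_comp (T.map f.hom) Y.str) g.cst.hom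
    simp only [whiskerRight_comp, Category.assoc, Iso.inv_comp_eq] at h4
    simp at h1 h2 h3 h4 h5 h6 ⊢
    rw [h5]
    simp
    rw [reassoc_of% h4, h6]
    simp
    rw [reassoc_of% h1, reassoc_of% h3]
    simp
    rw [reassoc_of% h2]
    simp

theorem PseudoHom.ext_of_eqToHom {X Y : T.Alg} {f g : PseudoHom X Y} (h : f.hom = g.hom)
    (hc : f.cst.hom = eqToHom (by rw [h]) ≫ g.cst.hom ≫ eqToHom (by rw [h])) : f = g := by
  obtain ⟨f, cf, _, _⟩ := f
  obtain ⟨g, cg, _, _⟩ := g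
  obtain rfl : f = g := h
  obtain rfl : cf = cg := by ext; simpa using hc
  rfl

/-- An algebra 2-cell between pseudomorphisms. -/
@[ext]
structure AlgTwoCell {X Y : T.Alg} (f g : PseudoHom X Y) where
  hom : f.hom ⟶ g.hom
  comm : T.map₂ hom ▷ Y.str ≫ g.cst.hom = f.cst.hom ≫ X.str ◁ hom

theorem whiskerLeft_comm {X Y Z : T.Alg} (f : PseudoHom X Y) {g h : PseudoHom Y Z}
    (θ : AlgTwoCell g h) :
    T.map₂ (f.hom ◁ θ.hom) ▷ Z.str ≫ (f.comp h).cst.hom =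
      (f.comp g).cst.hom ≫ X.str ◁ (f.hom ◁ θ.hom) := by
  have h1 := congr(T.map f.hom ◁ $(θ.comm))
  have h2 := congr((α_ _ _ _).inv ≫ $(whisker_exchange f.cst.hom θ.hom) ≫ (α_ _ _ _).hom)
  simp at h1 h2 ⊢
  rw [reassoc_of% h1, h2]

theorem whiskerRight_comm {X Y Z : T.Alg} {f g : PseudoHom X Y} (θ : AlgTwoCell f g)
    (h : PseudoHom Y Z) :
    T.map₂ (θ.hom ▷ h.hom) ▷ Z.str ≫ (g.comp h).cst.hom =
      (f.comp h).cst.hom ≫ X.str ◁ (θ.hom ▷ h.hom) := by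
  have h1 := congr($(θ.comm) ▷ h.hom ≫ (α_ _ _ _).hom)
  have h2 := congr($(whisker_exchange (T.map₂ θ.hom) h.cst.hom) ≫ (α_ _ _ _).inv)
  simp at h1 h2 ⊢
  rw [← h1, reassoc_of% h2]
  simp

theorem associator_comm {X Y Z W : T.Alg} (f : PseudoHom X Y) (g : PseudoHom Y Z)
    (h : PseudoHom Z W) :
    T.map₂ (α_ f.hom g.hom h.hom).hom ▷ W.str ≫ (f.comp (g.comp h)).cst.hom =
      ((f.comp g).comp h).cst.hom ≫ X.str ◁ (α_ f.hom g.hom h.hom).hom := by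
  have := congr_whiskerLeft (T.map_comp f.hom g.hom) h.cst.hom
  simp at this ⊢
  simp [this]

theorem leftUnitor_comm {X Y : T.Alg} (f : PseudoHom X Y) :
    T.map₂ (λ_ f.hom).hom ▷ Y.str ≫ f.cst.hom =
      ((PseudoHom.id X).comp f).cst.hom ≫ X.str ◁ (λ_ f.hom).hom := by
  have := congr_whiskerLeft (T.map_id _) f.cst.hom
  simp at this ⊢
  simp [this]

theorem rightUnitor_comm {X Y : T.Alg} (f : PseudoHom X Y) :
    T.map₂ (ρ_ f.hom).hom ▷ Y.str ≫ f.cst.hom =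
      (f.comp (PseudoHom.id Y)).cst.hom ≫ X.str ◁ (ρ_ f.hom).hom := by
  simp

/-- The inverse of an invertible algebra 2-cell is an algebra 2-cell. -/
@[simps]
def AlgTwoCell.ofInv {X Y : T.Alg} {f g : PseudoHom X Y} (θ : f.hom ≅ g.hom)
    (h : T.map₂ θ.hom ▷ Y.str ≫ g.cst.hom = f.cst.hom ≫ X.str ◁ θ.hom) : AlgTwoCell g f where
  hom := θ.inv
  comm := by
    rw [← cancel_epi (T.map₂ θ.hom ▷ Y.str), reassoc_of% h]
    simp [← comp_whiskerRight_assoc, ← PrelaxFunctor.map₂_comp]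

instance algHomCategory (X Y : T.Alg) : Category (PseudoHom X Y) where
  Hom := AlgTwoCell
  id f := ⟨𝟙 f.hom, by simp⟩
  comp θ χ := ⟨θ.hom ≫ χ.hom, by simp [χ.comm, reassoc_of% θ.comm]⟩
  id_comp _ := AlgTwoCell.ext (Category.id_comp _)
  comp_id _ := AlgTwoCell.ext (Category.comp_id _)
  assoc _ _ _ := AlgTwoCell.ext (Category.assoc _ _ _)

/-- The 2-category of algebras, pseudomorphisms and algebra 2-cells. -/
instance algBicategory (T : TwoMonad K) : Bicategory T.Alg where
  Hom := PseudoHom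
  id := PseudoHom.id
  comp := PseudoHom.comp
  homCategory := algHomCategory
  whiskerLeft f _ _ θ := ⟨f.hom ◁ θ.hom, whiskerLeft_comm f θ⟩
  whiskerRight θ h := ⟨θ.hom ▷ h.hom, whiskerRight_comm θ h⟩
  associator f g h :=
    { hom := ⟨(α_ f.hom g.hom h.hom).hom, associator_comm f g h⟩
      inv := .ofInv (α_ f.hom g.hom h.hom) (associator_comm f g h)
      hom_inv_id := AlgTwoCell.ext (Iso.hom_inv_id _)
      inv_hom_id := AlgTwoCell.ext (Iso.inv_hom_id _) }
  leftUnitor f :=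
    { hom := ⟨(λ_ f.hom).hom, leftUnitor_comm f⟩
      inv := .ofInv (λ_ f.hom) (leftUnitor_comm f)
      hom_inv_id := AlgTwoCell.ext (Iso.hom_inv_id _)
      inv_hom_id := AlgTwoCell.ext (Iso.inv_hom_id _) }
  rightUnitor f :=
    { hom := ⟨(ρ_ f.hom).hom, rightUnitor_comm f⟩
      inv := .ofInv (ρ_ f.hom) (rightUnitor_comm f)
      hom_inv_id := AlgTwoCell.ext (Iso.hom_inv_id _)
      inv_hom_id := AlgTwoCell.ext (Iso.inv_hom_id _) }
  whiskerLeft_id _ _ := AlgTwoCell.ext (whiskerLeft_id _ _)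
  whiskerLeft_comp _ _ _ _ _ _ := AlgTwoCell.ext (whiskerLeft_comp _ _ _)
  id_whiskerLeft _ := AlgTwoCell.ext (id_whiskerLeft _)
  comp_whiskerLeft _ _ _ _ _ := AlgTwoCell.ext (comp_whiskerLeft _ _ _)
  id_whiskerRight _ _ := AlgTwoCell.ext (id_whiskerRight _ _)
  comp_whiskerRight _ _ _ := AlgTwoCell.ext (comp_whiskerRight _ _ _)
  whiskerRight_id _ := AlgTwoCell.ext (whiskerRight_id _)
  whiskerRight_comp _ _ _ := AlgTwoCell.ext (whiskerRight_comp _ _ _)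
  whisker_assoc _ _ _ _ _ := AlgTwoCell.ext (whisker_assoc _ _ _)
  whisker_exchange _ _ := AlgTwoCell.ext (whisker_exchange _ _)
  pentagon _ _ _ _ := AlgTwoCell.ext (pentagon _ _ _ _)
  triangle _ _ := AlgTwoCell.ext (triangle _ _)

theorem PseudoHom.comp_id {X Y : T.Alg} (f : PseudoHom X Y) : f.comp (.id Y) = f :=
  PseudoHom.ext_of_eqToHom (Strict.comp_id _) (by simp)

theorem PseudoHom.id_comp {X Y : T.Alg} (f : PseudoHom X Y) : (PseudoHom.id X).comp f = f :=
  PseudoHom.ext_of_eqToHom (Strict.id_comp _) (by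
    have := congr_whiskerLeft (T.map_id _) f.cst.hom
    simp at this ⊢
    simp [this])

theorem PseudoHom.assoc {X Y Z W : T.Alg} (f : PseudoHom X Y) (g : PseudoHom Y Z)
    (h : PseudoHom Z W) :
    (f.comp g).comp h = f.comp (g.comp h) :=
  PseudoHom.ext_of_eqToHom (Strict.assoc _ _ _) (by
    have := congr_whiskerLeft (T.map_comp f.hom g.hom) h.cst.hom
    simp at this ⊢
    simp [this])

theorem AlgTwoCell.eqToHom_hom {X Y : T.Alg} {f g : PseudoHom X Y} (h : f = g) :
    (eqToHom h).hom = eqToHom (congrArg PseudoHom.hom h) := by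
  subst h
  rfl

instance algStrict (T : TwoMonad K) : Bicategory.Strict T.Alg where
  id_comp := PseudoHom.id_comp
  comp_id := PseudoHom.comp_id
  assoc := PseudoHom.assoc
  leftUnitor_eqToIso f := Iso.ext (AlgTwoCell.ext
    (congr(Iso.hom $(Strict.leftUnitor_eqToIso f.hom)).trans
      (AlgTwoCell.eqToHom_hom (PseudoHom.id_comp f)).symm))
  rightUnitor_eqToIso f := Iso.ext (AlgTwoCell.ext
    (congr(Iso.hom $(Strict.rightUnitor_eqToIso f.hom)).trans
      (AlgTwoCell.eqToHom_hom (PseudoHom.comp_id f)).symm))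
  associator_eqToIso f g h := Iso.ext (AlgTwoCell.ext
    (congr(Iso.hom $(Strict.associator_eqToIso f.hom g.hom h.hom)).trans
      (AlgTwoCell.eqToHom_hom (PseudoHom.assoc f g h)).symm))

/-! ### Strict morphisms -/

/-- A strict morphism of algebras. -/
@[ext]
structure StrictHom (X Y : T.Alg) where
  hom : X.carrier ⟶ Y.carrier
  comm : T.map hom ≫ Y.str = X.str ≫ hom

/-- A strict morphism, regarded as a pseudomorphism with identity constraint. -/
@[simps]
abbrev StrictHom.toPseudo {X Y : T.Alg} (f : StrictHom X Y) : PseudoHom X Y where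
  hom := f.hom
  cst := eqToIso f.comm
  unit := by simp
  mult := by simp

/-- The identity strict morphism. -/
@[simps]
abbrev StrictHom.id (X : T.Alg) : StrictHom X X where
  hom := 𝟙 X.carrier
  comm := by rw [T.map_id, Category.id_comp, Category.comp_id]

/-- The composite of strict morphisms. -/
@[simps]
abbrev StrictHom.comp {X Y Z : T.Alg} (f : StrictHom X Y) (g : StrictHom Y Z) : StrictHom X Z where
  hom := f.hom ≫ g.hom
  comm := by rw [T.map_comp, Category.assoc, g.comm, ← Category.assoc, f.comm, Category.assoc]

theorem StrictHom.toPseudo_id (X : T.Alg) : (StrictHom.id X).toPseudo = PseudoHom.id X := rfl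

theorem StrictHom.toPseudo_comp {X Y Z : T.Alg} (f : StrictHom X Y) (g : StrictHom Y Z) :
    (f.comp g).toPseudo = f.toPseudo.comp g.toPseudo :=
  PseudoHom.ext_of_eqToHom rfl (by simp)

instance strictHomCategory (X Y : T.Alg) : Category (StrictHom X Y) where
  Hom f g := AlgTwoCell f.toPseudo g.toPseudo
  id f := ⟨𝟙 f.hom, by simp⟩
  comp θ χ := ⟨AlgTwoCell.hom θ ≫ AlgTwoCell.hom χ, by
    have h₁ := AlgTwoCell.comm θ
    have h₂ := AlgTwoCell.comm χ
    rw [PrelaxFunctor.map₂_comp, comp_whiskerRight, Category.assoc, h₂, ← Category.assoc, h₁,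
      Category.assoc, ← whiskerLeft_comp]⟩
  id_comp θ := AlgTwoCell.ext (Category.id_comp (AlgTwoCell.hom θ))
  comp_id θ := AlgTwoCell.ext (Category.comp_id (AlgTwoCell.hom θ))
  assoc θ χ ψ := AlgTwoCell.ext
    (Category.assoc (AlgTwoCell.hom θ) (AlgTwoCell.hom χ) (AlgTwoCell.hom ψ))

/-- The algebras, as objects of the 2-category `T-Alg_s`. -/
structure AlgS (T : TwoMonad K) where
  toAlg : T.Alg

/-- The 2-category of algebras, strict morphisms and algebra 2-cells. -/
instance algSBicategory (T : TwoMonad K) : Bicategory T.AlgS where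
  Hom X Y := StrictHom X.toAlg Y.toAlg
  id X := StrictHom.id X.toAlg
  comp := StrictHom.comp
  homCategory X Y := strictHomCategory X.toAlg Y.toAlg
  whiskerLeft f _ _ θ := ⟨f.hom ◁ AlgTwoCell.hom θ, by
    simpa using whiskerLeft_comm f.toPseudo θ⟩
  whiskerRight θ h := ⟨AlgTwoCell.hom θ ▷ h.hom, by
    simpa using whiskerRight_comm θ h.toPseudo⟩
  associator f g h :=
    { hom := ⟨(α_ f.hom g.hom h.hom).hom, by simp⟩
      inv := ⟨(α_ f.hom g.hom h.hom).inv, by simp⟩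
      hom_inv_id := AlgTwoCell.ext (Iso.hom_inv_id _)
      inv_hom_id := AlgTwoCell.ext (Iso.inv_hom_id _) }
  leftUnitor f :=
    { hom := ⟨(λ_ f.hom).hom, by simp⟩
      inv := ⟨(λ_ f.hom).inv, by simp⟩
      hom_inv_id := AlgTwoCell.ext (Iso.hom_inv_id _)
      inv_hom_id := AlgTwoCell.ext (Iso.inv_hom_id _) }
  rightUnitor f :=
    { hom := ⟨(ρ_ f.hom).hom, by simp⟩
      inv := ⟨(ρ_ f.hom).inv, by simp⟩
      hom_inv_id := AlgTwoCell.ext (Iso.hom_inv_id _)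
      inv_hom_id := AlgTwoCell.ext (Iso.inv_hom_id _) }
  whiskerLeft_id _ _ := AlgTwoCell.ext (whiskerLeft_id _ _)
  whiskerLeft_comp _ _ _ _ _ _ := AlgTwoCell.ext (whiskerLeft_comp _ _ _)
  id_whiskerLeft _ := AlgTwoCell.ext (id_whiskerLeft _)
  comp_whiskerLeft _ _ _ _ _ := AlgTwoCell.ext (comp_whiskerLeft _ _ _)
  id_whiskerRight _ _ := AlgTwoCell.ext (id_whiskerRight _ _)
  comp_whiskerRight _ _ _ := AlgTwoCell.ext (comp_whiskerRight _ _ _)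
  whiskerRight_id _ := AlgTwoCell.ext (whiskerRight_id _)
  whiskerRight_comp _ _ _ := AlgTwoCell.ext (whiskerRight_comp _ _ _)
  whisker_assoc _ _ _ _ _ := AlgTwoCell.ext (whisker_assoc _ _ _)
  whisker_exchange _ _ := AlgTwoCell.ext (whisker_exchange _ _)
  pentagon _ _ _ _ := AlgTwoCell.ext (pentagon _ _ _ _)
  triangle _ _ := AlgTwoCell.ext (triangle _ _)

theorem StrictHom.eqToIso_hom {X Y : T.AlgS} {f g : X ⟶ Y} (h : f = g) :
    AlgTwoCell.hom (f := StrictHom.toPseudo f) (g := StrictHom.toPseudo g) (eqToIso h).hom =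
      (eqToIso (congrArg StrictHom.hom h)).hom := by
  subst h
  rfl

instance algSStrict (T : TwoMonad K) : Bicategory.Strict T.AlgS where
  id_comp f := StrictHom.ext (Strict.id_comp (StrictHom.hom f))
  comp_id f := StrictHom.ext (Strict.comp_id (StrictHom.hom f))
  assoc f g h := StrictHom.ext
    (Strict.assoc (StrictHom.hom f) (StrictHom.hom g) (StrictHom.hom h))
  leftUnitor_eqToIso f := Iso.ext (AlgTwoCell.ext
    (congr(Iso.hom $(Strict.leftUnitor_eqToIso (StrictHom.hom f))).trans
      (StrictHom.eqToIso_hom (f := 𝟙 _ ≫ f) (g := f) _).symm))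
  rightUnitor_eqToIso f := Iso.ext (AlgTwoCell.ext
    (congr(Iso.hom $(Strict.rightUnitor_eqToIso (StrictHom.hom f))).trans
      (StrictHom.eqToIso_hom (f := f ≫ 𝟙 _) (g := f) _).symm))
  associator_eqToIso f g h := Iso.ext (AlgTwoCell.ext
    (congr(Iso.hom $(Strict.associator_eqToIso (StrictHom.hom f) (StrictHom.hom g)
      (StrictHom.hom h))).trans
        (StrictHom.eqToIso_hom (f := (f ≫ g) ≫ h) (g := f ≫ g ≫ h) _).symm))

theorem AlgTwoCell.conj_hom {X Y : T.Alg} {f f' g g' : X ⟶ Y} (h : f = f') (h' : g' = g)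
    (hf : PseudoHom.hom f = PseudoHom.hom f') (hg : PseudoHom.hom g' = PseudoHom.hom g) (θ : f' ⟶ g') :
    AlgTwoCell.hom (eqToHom h ≫ θ ≫ eqToHom h') =
      eqToHom hf ≫ AlgTwoCell.hom θ ≫ eqToHom hg := by
  subst h h'
  rw [eqToHom_refl, eqToHom_refl, Category.id_comp, Category.comp_id, eqToHom_refl, eqToHom_refl,
    Category.id_comp, Category.comp_id]

/-- The inclusion 2-functor `T-Alg_s ⟶ T-Alg`. -/
def incl (T : TwoMonad K) : StrictPseudofunctor T.AlgS T.Alg :=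
  StrictPseudofunctor.mk''
    { obj X := X.toAlg
      map f := StrictHom.toPseudo f
      map₂ θ := θ
      map₂_id _ := rfl
      map₂_comp _ _ := rfl
      map_id X := StrictHom.toPseudo_id X.toAlg
      map_comp f g := StrictHom.toPseudo_comp (f : StrictHom _ _) g
      map₂_whisker_left f g g' θ := AlgTwoCell.ext
        (((Category.id_comp _).trans (Category.comp_id _)).symm.trans
          (AlgTwoCell.conj_hom (StrictHom.toPseudo_comp f g) (StrictHom.toPseudo_comp f g').symm
            rfl rfl (whiskerLeft (B := T.Alg) (StrictHom.toPseudo f) θ)).symm)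
      map₂_whisker_right {_ _ _ f f'} θ h := AlgTwoCell.ext
        (((Category.id_comp _).trans (Category.comp_id _)).symm.trans
          (AlgTwoCell.conj_hom (StrictHom.toPseudo_comp f h) (StrictHom.toPseudo_comp f' h).symm
            rfl rfl (whiskerRight (B := T.Alg) θ (StrictHom.toPseudo h))).symm) }

/-! ### Free algebras -/

/-- The free algebra `(T C, μ_C)`. -/
abbrev free (T : TwoMonad K) (C : K) : T.Alg where
  carrier := T.obj C
  str := T.μ C
  unit := T.left_unit C
  assoc := T.assoc C

/-- The strict morphism `T φ : T C ⟶ T C'`. -/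
abbrev freeMap (T : TwoMonad K) {C C' : K} (φ : C ⟶ C') : StrictHom (T.free C) (T.free C') where
  hom := T.map φ
  comm := T.μ_comm φ

/-- The strict morphism `μ_C : T (T C) ⟶ T C`. -/
abbrev freeMul (T : TwoMonad K) (C : K) : StrictHom (T.free (T.obj C)) (T.free C) where
  hom := T.μ C
  comm := T.assoc C

/-! ### Pseudomorphism classifiers -/

/-- A pseudomorphism classifier: a left 2-adjoint `Q` to the inclusion `T-Alg_s ⟶ T-Alg`, with unit
`ζ = adj.unit` and counit `δ = adj.counit`. -/
structure PseudomorphismClassifier (T : TwoMonad K) where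
  Q : StrictPseudofunctor T.Alg T.AlgS
  adj : TwoAdjunction Q T.incl

/-! ### Universal pseudomorphisms -/

/-- Morphisms `φ ⟶ ψ` in the arrow category of `K`. -/
abbrev ArrowHom {C C' D D' : K} (φ : C ⟶ C') (ψ : D ⟶ D') : Type v :=
  {p : (C ⟶ D) × (C' ⟶ D') // p.1 ≫ ψ = φ ≫ p.2}

/-- Morphisms `f ⟶ g` in the strict arrow category of pseudomorphisms: pairs of strict morphisms
forming a commutative square in `T-Alg`. -/
abbrev StrictArrowHom {X X' Y Y' : T.Alg} (f : PseudoHom X X') (g : PseudoHom Y Y') : Type v :=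
  {p : StrictHom X Y × StrictHom X' Y' // p.1.toPseudo.comp g = f.comp p.2.toPseudo}

/-- The map `Alg(f, g) ⟶ K(φ, g)` of arrow categories given by the forgetful functor followed by
precomposition with a morphism `e : φ ⟶ f`. -/
def StrictArrowHom.precomp {C C' : K} {φ : C ⟶ C'} {X X' Y Y' : T.Alg} {f : PseudoHom X X'}
    (e : ArrowHom φ f.hom) (g : PseudoHom Y Y') (p : StrictArrowHom f g) : ArrowHom φ g.hom :=
  ⟨(e.1.1 ≫ p.1.1.hom, e.1.2 ≫ p.1.2.hom), by
    have h : p.1.1.hom ≫ g.hom = f.hom ≫ p.1.2.hom := congrArg PseudoHom.hom p.2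
    rw [Category.assoc, h, ← Category.assoc, e.2, Category.assoc]⟩

/-- A universal pseudomorphism `hom : T C ⇝ obj` for a 1-cell `φ : C ⟶ C'`, with unit morphism
`(η_C, κ) : φ ⟶ hom` in the arrow category of `K`. -/
structure UniversalPseudomorphism (T : TwoMonad K) {C C' : K} (φ : C ⟶ C') where
  obj : T.Alg
  hom : PseudoHom (T.free C) obj
  κ : C' ⟶ obj.carrier
  comm : T.η C ≫ hom.hom = φ ≫ κ
  universal : ∀ {X Y : T.Alg} (f : PseudoHom X Y),
    Function.Bijective (StrictArrowHom.precomp (φ := φ) (f := hom) ⟨(T.η C, κ), comm⟩ f)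

namespace UniversalPseudomorphism

/-- For a morphism `(R, S) : φ ⟶ f` in the arrow category of `K`, the second component of the unique
morphism from the universal pseudomorphism to `f` that induces it. -/
noncomputable def extend {C C' : K} {φ : C ⟶ C'} (U : T.UniversalPseudomorphism φ) {X Y : T.Alg}
    (f : PseudoHom X Y) (p : ArrowHom φ f.hom) : StrictHom U.obj Y :=
  ((Equiv.ofBijective _ (U.universal f)).symm p).1.2

/-- The strict morphism `Δ : T(C', φ) ⟶ T C'` induced by `(η_C, η_{C'}) : φ ⟶ T φ`. -/
noncomputable def delta {C C' : K} {φ : C ⟶ C'} (U : T.UniversalPseudomorphism φ) :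
    StrictHom U.obj (T.free C') :=
  U.extend (T.freeMap φ).toPseudo ⟨(T.η C, T.η C'), (T.η_comm φ).symm⟩

end UniversalPseudomorphism

/-- A choice of a universal pseudomorphism for each 1-cell of `K`. -/
structure UniversalPseudomorphisms (T : TwoMonad K) where
  univ : ∀ {C C' : K} (φ : C ⟶ C'), T.UniversalPseudomorphism φ

namespace UniversalPseudomorphisms

variable (U : T.UniversalPseudomorphisms)

/-- `P C = T(C, 1_C)`. -/
def P (C : K) : T.Alg := (U.univ (𝟙 C)).obj

/-- The universal pseudomorphism `T C ⇝ P C` of the identity of `C`. -/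
def tilde (C : K) : PseudoHom (T.free C) (U.P C) := (U.univ (𝟙 C)).hom

/-- For a pseudomorphism `f : T C ⇝ T C'`, the strict morphism `P f : P C ⟶ P C'` induced by
`(η_C, S) : 1_C ⟶ tilde C' ∘ f`, where `S = tilde C' ∘ f ∘ η_C`. -/
noncomputable def mapP {C C' : K} (f : PseudoHom (T.free C) (T.free C')) :
    StrictHom (U.P C) (U.P C') :=
  (U.univ (𝟙 C)).extend (f.comp (U.tilde C'))
    ⟨(T.η C, T.η C ≫ f.hom ≫ (U.tilde C').hom), (Category.id_comp _).symm⟩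

/-- `T-Alg_s` has coequalizers of all `P`-free pairs `P μ, P (T x) : P (T X) ⇉ P X`, for the
algebras `(X, x)`. -/
def HasCoequalizersOfPFreePairs : Prop :=
  ∀ X : T.Alg, Limits.HasCoequalizer (C := T.AlgS) (X := ⟨U.P (T.obj X.carrier)⟩)
    (Y := ⟨U.P X.carrier⟩) (U.mapP (T.freeMul X.carrier).toPseudo) (U.mapP (T.freeMap X.str).toPseudo)

end UniversalPseudomorphisms

end TwoMonad

end TwoDim

/-! Pseudolimits of 1-cells and cotensors with the free arrow lift from `K` to algebras: if `f` is a
pseudomorphism, the limit of its underlying 1-cell carries an algebra structure for which the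
projections are strict, and it is universal among pseudomorphisms (`ArrowLimit.exists_algLift`). A
pseudomorphism into it is strict as soon as both of its projections are. Every 2-cell needed below
arises from a 1-cell into such a limit, produced by a one-dimensional universal property.

From a classifier, `T(C', φ)` is the pushout along `T φ` of the strict map `T C ⟶ Q(T C)` that
extends `ζ ∘ η`. Conversely, the universal pseudomorphism of `1_C` classifies pseudomorphisms out of
the free algebra `T C`. Any algebra `(X, x)` is the coequalizer of `μ` and `T x` in `T-Alg`
(`exists_strHom_comp`, `strHom_comp_injective`), so the coequalizer of its `P`-free pair in
`T-Alg_s` classifies `X`. Cotensors with the free arrow upgrade this to the two-dimensional property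
(`IsClassifier.exists_cell`, `IsClassifier.cell_ext`), and universal arrows assemble into a
2-adjunction.

For the equivalences, an identity or invertible 2-cell is encoded as a pseudomorphism into a
pseudolimit, and the universal property replaces it by a strict morphism `k`. One projection of `k`
is the identity and the other is the composite to be compared with it, so the universal 2-cell
whiskered by `k` is the required isomorphism. -/

namespace TwoDim

attribute [-instance] ReflQuiver.toQuiver

/-! ### Pseudolimits of 1-cells and cotensors with the free arrow, treated uniformly. -/

section ArrowLimit

variable {K : Type u} [Bicategory.{w, v} K] [Bicategory.Strict K]

/-- The universal object `L` with projections to `A` and `B` and a 2-cell `f ∘ fst ⟶ snd`, which is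
invertible and universal among the invertible ones if `inv` holds. For `inv = True` this is a
pseudolimit of `f`; for `inv = False` and `f = 1_A` it is the cotensor of `A` with the free arrow. -/
structure ArrowLimit (inv : Prop) {A B : K} (f : A ⟶ B) where
  obj : K
  fst : obj ⟶ A
  snd : obj ⟶ B
  cell : fst ≫ f ⟶ snd
  isIso_cell : inv → IsIso cell
  exists_lift : ∀ {W : K} (a : W ⟶ A) (b : W ⟶ B) (σ : a ≫ f ⟶ b), (inv → IsIso σ) →
    ∃ (z : W ⟶ obj) (ha : z ≫ fst = a) (hb : z ≫ snd = b),
      z ◁ cell = eqToHom (by rw [← ha, Category.assoc]) ≫ σ ≫ eqToHom hb.symm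
  hom_ext : ∀ {W : K} {z z' : W ⟶ obj} (h₁ : z ≫ fst = z' ≫ fst) (h₂ : z ≫ snd = z' ≫ snd),
    z ◁ cell = eqToHom (by rw [← Category.assoc, h₁, Category.assoc]) ≫ z' ◁ cell ≫ eqToHom h₂.symm →
      z = z'
  exists_lift₂ : ∀ {W : K} {z z' : W ⟶ obj} (ξ : z ≫ fst ⟶ z' ≫ fst) (χ : z ≫ snd ⟶ z' ≫ snd),
    ξ ▷ f ≫ eqToHom (Category.assoc _ _ _) ≫ z' ◁ cell =
      eqToHom (Category.assoc _ _ _) ≫ z ◁ cell ≫ χ → ∃ ω : z ⟶ z', ω ▷ fst = ξ ∧ ω ▷ snd = χ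
  hom_ext₂ : ∀ {W : K} {z z' : W ⟶ obj} {ω ω' : z ⟶ z'}, ω ▷ fst = ω' ▷ fst →
    ω ▷ snd = ω' ▷ snd → ω = ω'

/-- A pseudolimit of a 1-cell, as an `ArrowLimit`. -/
def ArrowLimit.ofPseudolimit {A B : K} {f : A ⟶ B} (L : Pseudolimit f) : ArrowLimit True f where
  obj := L.obj
  fst := L.fst
  snd := L.snd
  cell := L.iso.hom
  isIso_cell _ := inferInstance
  exists_lift a b σ hσ := by
    have := hσ trivial
    obtain ⟨z, ⟨ha, hb, h⟩, -⟩ := L.universal a b (asIso σ)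
    refine ⟨z, ha.symm, hb, ?_⟩
    rw [← asIso_hom σ, ← h]
    simp
  hom_ext {W z z'} h₁ h₂ h := by
    obtain ⟨y, -, hy⟩ := L.universal (z ≫ L.fst) (z ≫ L.snd)
      (eqToIso (Category.assoc _ _ _) ≪≫ whiskerLeftIso z L.iso)
    exact (hy z ⟨rfl, rfl, by simp⟩).trans (hy z' ⟨h₁, h₂.symm, by simp [h]⟩).symm
  exists_lift₂ {W z z'} ξ χ h := by
    obtain ⟨ω, hω, -⟩ := L.universal₂ z z' ξ χ (by
      simpa [Strict.associator_eqToIso, eqToHom_comp_iff] using h)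
    exact ⟨ω, hω⟩
  hom_ext₂ {W z z' ω ω'} h₁ h₂ := by
    obtain ⟨y, -, hy⟩ := L.universal₂ z z' (ω ▷ _) (ω ▷ _)
      (by simpa using (whisker_exchange ω L.iso.hom).symm)
    exact (hy ω ⟨rfl, rfl⟩).trans (hy ω' ⟨h₁.symm, h₂.symm⟩).symm

/-- A cotensor with the free arrow, as an `ArrowLimit`. -/
def ArrowLimit.ofCotensor {A : K} (L : Cotensor (Fin 2) A) : ArrowLimit False (𝟙 A) where
  obj := L.obj
  fst := L.cone.obj 0
  snd := L.cone.obj 1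
  cell := eqToHom (Category.comp_id _) ≫ L.cone.map (homOfLE (Fin.zero_le 1))
  isIso_cell h := h.elim
  exists_lift {W} a b σ _ := by
    obtain ⟨z, hz⟩ := (L.universal W).bijective_obj.2
      (ComposableArrows.mk₁ (eqToHom (Category.comp_id a).symm ≫ σ))
    have h0 : z ≫ L.cone.obj 0 = a := Functor.congr_obj hz 0
    have h1 : z ≫ L.cone.obj 1 = b := Functor.congr_obj hz 1
    have h : z ◁ L.cone.map (homOfLE (Fin.zero_le 1)) =
        eqToHom h0 ≫ (eqToHom (Category.comp_id a).symm ≫ σ) ≫ eqToHom h1.symm :=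
      Functor.congr_hom hz (homOfLE (Fin.zero_le 1))
    exact ⟨z, h0, h1, by simp [h]⟩
  hom_ext {W z z'} h₁ h₂ h := by
    apply (L.universal W).bijective_obj.1
    refine ComposableArrows.ext₁ h₁ h₂ ?_
    have h' : z ◁ L.cone.map (homOfLE (Fin.zero_le 1)) =
        eqToHom h₁ ≫ z' ◁ L.cone.map (homOfLE (Fin.zero_le 1)) ≫ eqToHom h₂.symm := by
      simpa [eqToHom_comp_iff] using h
    exact h'
  exists_lift₂ {W z z'} ξ χ h := by
    obtain ⟨full⟩ := (L.universal W).full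
    obtain ⟨ω, hω⟩ := @full z z' (ComposableArrows.homMk₁ ξ χ (by
        change z ◁ L.cone.map (homOfLE (Fin.zero_le 1)) ≫ _ =
          _ ≫ z' ◁ L.cone.map (homOfLE (Fin.zero_le 1))
        simpa [eqToHom_comp_iff, Strict.rightUnitor_eqToIso] using h.symm))
    refine ⟨ω, congr(($hω).app 0), congr(($hω).app 1)⟩
  hom_ext₂ {W z z' ω ω'} h₁ h₂ := by
    obtain ⟨inj⟩ := (L.universal W).faithful
    exact inj (ComposableArrows.hom_ext₁ h₁ h₂)
 

end ArrowLimit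

namespace TwoMonad

variable {K : Type u} [Bicategory.{w, v} K] [Bicategory.Strict K] {T : TwoMonad K}

attribute [local simp] PrelaxFunctor.map₂_eqToHom StrictPseudofunctor.mapComp_eq_eqToIso
  Strict.leftUnitor_eqToIso Strict.rightUnitor_eqToIso Strict.associator_eqToIso

/-! ### Whiskering identities in a strict 2-category. -/

section Cells

/-- Whiskering by a composite 1-cell, when the composite is only propositionally equal. -/
theorem whiskerLeft_whiskerLeft_of_eq {X Y Y' Z W : K} {p : X ⟶ Y} {q : Y ⟶ Z} {p' : X ⟶ Y'}
    {q' : Y' ⟶ Z} (h : p ≫ q = p' ≫ q') {f g : Z ⟶ W} (θ : f ⟶ g) :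
    p ◁ q ◁ θ = eqToHom (by rw [← Category.assoc, h, Category.assoc]) ≫ p' ◁ q' ◁ θ ≫
      eqToHom (by rw [← Category.assoc, ← h, Category.assoc]) := by
  have := congr_whiskerLeft h θ
  simp [eqToHom_comp_iff, comp_eqToHom_iff] at this
  simp [this]

theorem whiskerLeft_whiskerLeft_of_eq_id {X Y Z : K} {p : X ⟶ Y} {q : Y ⟶ X}
    (h : p ≫ q = 𝟙 X) {f g : X ⟶ Z} (θ : f ⟶ g) :
    p ◁ q ◁ θ = eqToHom (by rw [← Category.assoc, h, Category.id_comp]) ≫ θ ≫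
      eqToHom (by rw [← Category.assoc, h, Category.id_comp]) := by
  have := congr_whiskerLeft h θ
  simp [eqToHom_comp_iff, comp_eqToHom_iff] at this
  simp [this]

theorem whiskerRight_whiskerRight_of_eq {X Y Z Z' W : K} {p : Y ⟶ Z} {q : Z ⟶ W} {p' : Y ⟶ Z'}
    {q' : Z' ⟶ W} (h : p ≫ q = p' ≫ q') {f g : X ⟶ Y} (θ : f ⟶ g) :
    θ ▷ p ▷ q = eqToHom (by rw [Category.assoc, h, Category.assoc]) ≫ θ ▷ p' ▷ q' ≫
      eqToHom (by rw [Category.assoc, ← h, Category.assoc]) := by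
  have := whiskerRight_congr h θ
  simp [eqToHom_comp_iff, comp_eqToHom_iff] at this
  simp [this]

theorem whiskerRight_whiskerRight_of_eq_id {X Y Z : K} {p : Y ⟶ Z} {q : Z ⟶ Y}
    (h : p ≫ q = 𝟙 Y) {f g : X ⟶ Y} (θ : f ⟶ g) :
    θ ▷ p ▷ q = eqToHom (by rw [Category.assoc, h, Category.comp_id]) ≫ θ ≫
      eqToHom (by rw [Category.assoc, h, Category.comp_id]) := by
  have := whiskerRight_congr h θ
  simp [eqToHom_comp_iff, comp_eqToHom_iff] at this
  simp [this]

theorem map_comp_whiskerLeft {X Y Z W : K} (p : X ⟶ Y) (q : Y ⟶ Z) {f g : T.obj Z ⟶ W}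
    (θ : f ⟶ g) :
    T.map (p ≫ q) ◁ θ = eqToHom (by rw [T.map_comp, Category.assoc]) ≫ T.map p ◁ T.map q ◁ θ ≫
      eqToHom (by rw [T.map_comp, Category.assoc]) := by
  have := congr_whiskerLeft (T.map_comp p q) θ
  simp at this
  simp [this]

theorem η_whiskerLeft_map {X Y W : K} (p : X ⟶ Y) {f g : T.obj Y ⟶ W} (θ : f ⟶ g) :
    T.η X ◁ T.map p ◁ θ = eqToHom (by rw [← Category.assoc, ← T.η_comm, Category.assoc]) ≫
      p ◁ T.η Y ◁ θ ≫ eqToHom (by rw [← Category.assoc, T.η_comm, Category.assoc]) :=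
  whiskerLeft_whiskerLeft_of_eq (T.η_comm p).symm θ

theorem μ_whiskerLeft_map {X Y W : K} (p : X ⟶ Y) {f g : T.obj Y ⟶ W} (θ : f ⟶ g) :
    T.μ X ◁ T.map p ◁ θ = eqToHom (by rw [← Category.assoc, ← T.μ_comm, Category.assoc]) ≫
      T.map (T.map p) ◁ T.μ Y ◁ θ ≫
        eqToHom (by rw [← Category.assoc, T.μ_comm, Category.assoc]) :=
  whiskerLeft_whiskerLeft_of_eq (T.μ_comm p).symm θ

theorem η_whiskerLeft_map₂ {X Y W : K} {f g : X ⟶ Y} (θ : f ⟶ g) (h : T.obj Y ⟶ W) :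
    T.η X ◁ T.map₂ θ ▷ h = eqToHom (by rw [← Category.assoc, ← T.η_comm, Category.assoc]) ≫
      θ ▷ T.η Y ▷ h ≫ eqToHom (by rw [Category.assoc, ← Category.assoc, T.η_comm, Category.assoc]) := by
  have := congr($(T.η_comm₂ θ) ▷ h)
  simp at this
  simp [this]

theorem μ_whiskerLeft_map₂ {X Y W : K} {f g : X ⟶ Y} (θ : f ⟶ g) (h : T.obj Y ⟶ W) :
    T.μ X ◁ T.map₂ θ ▷ h = eqToHom (by rw [← Category.assoc, ← T.μ_comm, Category.assoc]) ≫
      T.map₂ (T.map₂ θ) ▷ T.μ Y ▷ h ≫ eqToHom (by rw [Category.assoc, ← Category.assoc, T.μ_comm, Category.assoc]) := by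
  have := congr($(T.μ_comm₂ θ) ▷ h)
  simp at this
  simp [this]

theorem whiskerRight_η_str (Y : T.Alg) {X : K} {f g : X ⟶ Y.carrier} (θ : f ⟶ g) :
    θ ▷ T.η Y.carrier ▷ Y.str = eqToHom (by rw [Category.assoc, Y.unit, Category.comp_id]) ≫ θ ≫
      eqToHom (by rw [Category.assoc, Y.unit, Category.comp_id]) :=
  whiskerRight_whiskerRight_of_eq_id Y.unit θ

theorem whiskerRight_μ_str (Y : T.Alg) {X : K} {f g : X ⟶ T.obj (T.obj Y.carrier)} (θ : f ⟶ g) :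
    θ ▷ T.μ Y.carrier ▷ Y.str = eqToHom (by rw [Category.assoc, ← Y.assoc, Category.assoc]) ≫
      θ ▷ T.map Y.str ▷ Y.str ≫ eqToHom (by rw [Category.assoc, Y.assoc, Category.assoc]) :=
  whiskerRight_whiskerRight_of_eq Y.assoc.symm θ

end Cells


/-! ### Lifting limits of arrows to algebras. -/

theorem PseudoHom.inv_mult {A B : T.Alg} (f : PseudoHom A B) :
    T.map A.str ◁ f.cst.inv ≫ eqToHom (mult_mid f.hom).symm ≫ T.map₂ f.cst.inv ▷ B.str =
      eqToHom (mult_tgt f.hom) ≫ T.μ A.carrier ◁ f.cst.inv ≫ eqToHom (mult_src f.hom).symm := by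
  have h := f.mult
  rw [← cancel_epi (T.map₂ f.cst.hom ▷ B.str ≫ eqToHom (mult_mid f.hom) ≫
    T.map A.str ◁ f.cst.hom)]
  nth_rw 2 [h]
  simp [← comp_whiskerRight, ← PrelaxFunctor.map₂_comp, ← whiskerLeft_comp_assoc]

theorem PseudoHom.inv_unit {A B : T.Alg} (f : PseudoHom A B) :
    T.η A.carrier ◁ f.cst.inv = eqToHom (unit_src f.hom).symm := by
  rw [← cancel_epi (T.η A.carrier ◁ f.cst.hom), ← whiskerLeft_comp, f.unit]
  simp

namespace ArrowLimit

variable {A B : T.Alg} {f : PseudoHom A B} {inv : Prop} (L : ArrowLimit inv f.hom)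

/-- The 2-cell that induces the algebra structure on a limit of an arrow. -/
abbrev strCell : (T.map L.fst ≫ A.str) ≫ f.hom ⟶ T.map L.snd ≫ B.str :=
  eqToHom (Category.assoc _ _ _) ≫ T.map L.fst ◁ f.cst.inv ≫
    eqToHom (by rw [T.map_comp, Category.assoc]) ≫ T.map₂ L.cell ▷ B.str

/-- These equations say that the projections are strict and that `cell` is an algebra 2-cell;
solving the latter for `l ◁ L.cell` brings in the inverse of the constraint of `f`. When `inv`
holds, `strCell` is invertible because `T` preserves invertible 2-cells. -/
theorem exists_str : ∃ (l : T.obj L.obj ⟶ L.obj) (h₁ : l ≫ L.fst = T.map L.fst ≫ A.str)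
    (h₂ : l ≫ L.snd = T.map L.snd ≫ B.str),
    l ◁ L.cell = eqToHom (by rw [← h₁, Category.assoc]) ≫ strCell L ≫ eqToHom h₂.symm := 
  L.exists_lift _ _ _ fun h => by
    have := L.isIso_cell h
    have : IsIso (T.map₂ L.cell) := inferInstance
    infer_instance

/-- The algebra structure on a limit of a pseudomorphism. -/
noncomputable def str : T.obj L.obj ⟶ L.obj := (exists_str L).choose

theorem str_fst : str L ≫ L.fst = T.map L.fst ≫ A.str := (exists_str L).choose_spec.choose

theorem str_snd : str L ≫ L.snd = T.map L.snd ≫ B.str :=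
  (exists_str L).choose_spec.choose_spec.choose

theorem str_cell : str L ◁ L.cell =
    eqToHom (by rw [← Category.assoc, str_fst, Category.assoc]) ≫ T.map L.fst ◁ f.cst.inv ≫
      eqToHom (by rw [T.map_comp, Category.assoc]) ≫ T.map₂ L.cell ▷ B.str ≫
        eqToHom (str_snd L).symm := by
  have h : str L ◁ L.cell = _ := (exists_str L).choose_spec.choose_spec.choose_spec
  rw [h]
  simp
  rfl

/-- A limit of a pseudomorphism, as an algebra. -/
noncomputable abbrev alg : T.Alg where
  carrier := L.obj
  str := str L
  unit := by
    have h₁ : (T.η _ ≫ str L) ≫ L.fst = 𝟙 _ ≫ L.fst := by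
      rw [Category.assoc, str_fst, ← Category.assoc, ← T.η_comm, Category.assoc, A.unit,
        Category.comp_id, Category.id_comp]
    have h₂ : (T.η _ ≫ str L) ≫ L.snd = 𝟙 _ ≫ L.snd := by
      rw [Category.assoc, str_snd, ← Category.assoc, ← T.η_comm, Category.assoc, B.unit,
        Category.comp_id, Category.id_comp]
    refine L.hom_ext h₁ h₂ ?_
    simp [str_cell, η_whiskerLeft_map, PseudoHom.inv_unit, η_whiskerLeft_map₂, whiskerRight_η_str]
  assoc := by
    have h₁ : (T.map (str L) ≫ str L) ≫ L.fst = (T.μ _ ≫ str L) ≫ L.fst := by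
      rw [Category.assoc, str_fst, ← Category.assoc, ← T.map_comp, str_fst, T.map_comp,
        Category.assoc, A.assoc, ← Category.assoc, T.μ_comm, Category.assoc, Category.assoc, str_fst]
    have h₂ : (T.map (str L) ≫ str L) ≫ L.snd = (T.μ _ ≫ str L) ≫ L.snd := by
      rw [Category.assoc, str_snd, ← Category.assoc, ← T.map_comp, str_snd, T.map_comp,
        Category.assoc, B.assoc, ← Category.assoc, T.μ_comm, Category.assoc, Category.assoc, str_snd]
    refine L.hom_ext h₁ h₂ ?_
    have h3 := congr(T.map₂ $(str_cell L) ▷ B.str)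
    have h4 := whiskerLeft_whiskerLeft_of_eq (p := T.map (str L)) (q := T.map L.fst)
      (p' := T.map (T.map L.fst)) (q' := T.map A.str)
      (by rw [← T.map_comp, str_fst, T.map_comp]) f.cst.inv
    -- Measured against `cell`, associativity is the multiplication axiom of `f`, read for the
    -- inverse constraint.
    have h5 := congr(T.map (T.map L.fst) ◁ $(PseudoHom.inv_mult f))
    simp [eqToHom_comp_iff, comp_eqToHom_iff] at h3 h4 h5
    simp [str_cell, h3, h4, μ_whiskerLeft_map, μ_whiskerLeft_map₂, whiskerRight_μ_str]
    rw [reassoc_of% h5]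
    simp

end ArrowLimit

end TwoMonad

/-- The inverse pair satisfies the reversed compatibility, so both directions lift, and `hom_ext₂`
makes the lifts mutually inverse. This supplies the constraints of pseudomorphisms into the limit.
-/
theorem ArrowLimit.exists_iso_lift₂ {K : Type u} [Bicategory.{w, v} K] [Bicategory.Strict K]
    {inv : Prop} {A B : K} {f : A ⟶ B} (L : ArrowLimit inv f) {W : K} {z z' : W ⟶ L.obj}
    (ξ : z ≫ L.fst ≅ z' ≫ L.fst) (χ : z ≫ L.snd ≅ z' ≫ L.snd)
    (h : ξ.hom ▷ f ≫ eqToHom (Category.assoc _ _ _) ≫ z' ◁ L.cell =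
      eqToHom (Category.assoc _ _ _) ≫ z ◁ L.cell ≫ χ.hom) :
    ∃ ω : z ≅ z', ω.hom ▷ L.fst = ξ.hom ∧ ω.hom ▷ L.snd = χ.hom := by
  obtain ⟨ω, h₁, h₂⟩ := L.exists_lift₂ ξ.hom χ.hom h
  obtain ⟨ω', h₁', h₂'⟩ := L.exists_lift₂ ξ.inv χ.inv (by
    rw [← cancel_epi (ξ.hom ▷ f), ← cancel_mono χ.hom]
    simp only [Category.assoc, Iso.inv_hom_id, Category.comp_id, ← comp_whiskerRight_assoc,
      Iso.hom_inv_id, id_whiskerRight, Category.id_comp]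
    exact h.symm)
  exact ⟨⟨ω, ω', L.hom_ext₂ (by simp [h₁, h₁']) (by simp [h₂, h₂']),
    L.hom_ext₂ (by simp [h₁, h₁']) (by simp [h₂, h₂'])⟩, h₁, h₂⟩

namespace TwoMonad

variable {K : Type u} [Bicategory.{w, v} K] [Bicategory.Strict K] {T : TwoMonad K}

attribute [local simp] PrelaxFunctor.map₂_eqToHom StrictPseudofunctor.mapComp_eq_eqToIso
  Strict.leftUnitor_eqToIso Strict.rightUnitor_eqToIso Strict.associator_eqToIso

theorem PseudoHom.cst_whiskerRight {X Y Z : T.Alg} (z : PseudoHom X Y) (u : StrictHom Y Z) :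
    z.cst.hom ▷ u.hom = eqToHom (by rw [T.map_comp, Category.assoc, Category.assoc, u.comm]) ≫
      (z.comp u.toPseudo).cst.hom ≫ eqToHom (Category.assoc _ _ _).symm := by
  simp

/-- With `hom_ext₂`, this shows that a constraint into a limit is determined by those of the two
projected pseudomorphisms. -/
theorem PseudoHom.cst_whiskerRight_heq {X Y Z : T.Alg} {z z' : PseudoHom X Y} {u : StrictHom Y Z}
    (h : z.comp u.toPseudo = z'.comp u.toPseudo) : z.cst.hom ▷ u.hom ≍ z'.cst.hom ▷ u.hom := by
  rw [z.cst_whiskerRight, z'.cst_whiskerRight, eqToHom_comp_heq_iff, comp_eqToHom_heq_iff,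
    heq_eqToHom_comp_iff, heq_comp_eqToHom_iff, h]

namespace ArrowLimit

variable {A B : T.Alg} {f : PseudoHom A B} {inv : Prop} (L : ArrowLimit inv f.hom)

/-- The first projection, as a strict morphism. -/
noncomputable abbrev algFst : StrictHom (alg L) A := ⟨L.fst, (str_fst L).symm⟩

/-- The second projection, as a strict morphism. -/
noncomputable abbrev algSnd : StrictHom (alg L) B := ⟨L.snd, (str_snd L).symm⟩

/-- The universal 2-cell, as an algebra 2-cell. -/
noncomputable def algCell : AlgTwoCell ((algFst L).toPseudo.comp f) (algSnd L).toPseudo where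
  hom := L.cell
  comm := by
    simp [str_cell, ← whiskerLeft_comp_assoc]

/-- The 1-dimensional universal property of the limit, for pseudomorphisms. -/
theorem exists_algLift {W : T.Alg} (p : PseudoHom W A) (q : PseudoHom W B)
    (σ : AlgTwoCell (p.comp f) q) (hσ : inv → IsIso σ.hom) :
    ∃ (z : PseudoHom W (alg L)) (h₁ : z.comp (algFst L).toPseudo = p)
      (h₂ : z.comp (algSnd L).toPseudo = q), z.hom ◁ L.cell =
        eqToHom (by rw [← h₁]; exact (Category.assoc _ _ _).symm) ≫ σ.hom ≫
          eqToHom (by rw [← h₂]) := by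
  obtain ⟨σ, comm⟩ := σ
  obtain ⟨p, pc, pu, pm⟩ := p
  obtain ⟨q, qc, qu, qm⟩ := q
  obtain ⟨z, rfl, rfl, hz⟩ := L.exists_lift p q σ hσ
  replace hz : σ = eqToHom (Category.assoc _ _ _) ≫ z ◁ L.cell := by simp [hz]
  subst hz
  -- The constraint of `z` is the 2-cell that projects to those of `p` and `q`; the compatibility it
  -- needs is exactly that `σ` is an algebra 2-cell.
  obtain ⟨ω, h₁, h₂⟩ := L.exists_iso_lift₂ (z := T.map z ≫ str L) (z' := W.str ≫ z)
    (eqToIso (by rw [Category.assoc, str_fst, T.map_comp, Category.assoc]) ≪≫ pc ≪≫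
      eqToIso (Category.assoc _ _ _).symm)
    (eqToIso (by rw [Category.assoc, str_snd, T.map_comp, Category.assoc]) ≪≫ qc ≪≫
      eqToIso (Category.assoc _ _ _).symm) (by
    have h := congr(T.map z ◁ T.map L.fst ◁ f.cst.inv ≫ eqToHom
      (by rw [T.map_comp, Category.assoc, T.map_comp, Category.assoc]) ≫ $comm)
    simp [map_comp_whiskerLeft, ← whiskerLeft_comp_assoc] at h
    simp [str_cell, reassoc_of% h])
  simp at h₁ h₂
  refine ⟨⟨z, ω, ?_, ?_⟩, ?_, ?_, ?_⟩
  -- Both axioms are checked after projection, where they become the axioms of `p` and `q`.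
  · apply L.hom_ext₂
    · have := congr(T.η _ ◁ $h₁)
      simp [pu] at this
      simp [this]
    · have := congr(T.η _ ◁ $h₂)
      simp [qu] at this
      simp [this]
  · apply L.hom_ext₂
    · have h3 := congr(T.map₂ $h₁ ▷ A.str)
      have h4 := congr(T.map W.str ◁ $h₁)
      have h5 := congr(T.μ _ ◁ $h₁)
      have h6 := whiskerRight_whiskerRight_of_eq (str_fst L) (T.map₂ ω.hom)
      simp [eqToHom_comp_iff, comp_eqToHom_iff] at h3 h4 h5 pm
      simp [h3, h4, h5, h6, reassoc_of% pm]
    · have h3 := congr(T.map₂ $h₂ ▷ B.str)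
      have h4 := congr(T.map W.str ◁ $h₂)
      have h5 := congr(T.μ _ ◁ $h₂)
      have h6 := whiskerRight_whiskerRight_of_eq (str_snd L) (T.map₂ ω.hom)
      simp [eqToHom_comp_iff, comp_eqToHom_iff] at h3 h4 h5 qm
      simp [h3, h4, h5, h6, reassoc_of% qm]
  · exact PseudoHom.ext_of_eqToHom rfl (by simp [h₁])
  · exact PseudoHom.ext_of_eqToHom rfl (by simp [h₂])
  · simp

theorem alg_hom_ext {W : T.Alg} {z z' : PseudoHom W (alg L)}
    (h₁ : z.comp (algFst L).toPseudo = z'.comp (algFst L).toPseudo)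
    (h₂ : z.comp (algSnd L).toPseudo = z'.comp (algSnd L).toPseudo)
    (hc : z.hom ◁ L.cell = eqToHom (by
      rw [← Category.assoc, show z.hom ≫ L.fst = _ from congr(PseudoHom.hom $h₁)]
      exact Category.assoc _ _ _) ≫ z'.hom ◁ L.cell ≫ eqToHom congr(PseudoHom.hom $h₂).symm) :
    z = z' := by
  have hz : z.hom = z'.hom := L.hom_ext congr(PseudoHom.hom $h₁) congr(PseudoHom.hom $h₂) hc
  obtain ⟨z, c, _, _⟩ := z
  obtain ⟨z', c', _, _⟩ := z'
  obtain rfl : z = z' := hz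
  obtain rfl : c = c' := Iso.ext (L.hom_ext₂ (eq_of_heq (PseudoHom.cst_whiskerRight_heq h₁))
    (eq_of_heq (PseudoHom.cst_whiskerRight_heq h₂)))
  rfl

end ArrowLimit

theorem PseudoHom.exists_toPseudo_eq {X Y : T.Alg} (p : PseudoHom X Y)
    (h : T.map p.hom ≫ Y.str = X.str ≫ p.hom) (hc : p.cst.hom = eqToHom h) :
    ∃ s : StrictHom X Y, s.toPseudo = p :=
  ⟨⟨p.hom, h⟩, PseudoHom.ext_of_eqToHom rfl (by simp [hc])⟩

theorem PseudoHom.cst_eq_of_toPseudo_eq {X Y : T.Alg} {s : StrictHom X Y} {p : PseudoHom X Y}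
    (h : p = s.toPseudo) : p.cst.hom = eqToHom (by subst h; exact s.comm) := by
  subst h
  rfl

namespace ArrowLimit

variable {A B : T.Alg} {f : PseudoHom A B} {inv : Prop} (L : ArrowLimit inv f.hom)

/-- A pseudomorphism into the limit is strict if its composites with the projections are. -/
theorem exists_toPseudo_eq {W : T.Alg} (z : PseudoHom W (alg L)) {a : StrictHom W A}
    {b : StrictHom W B} (h₁ : z.comp (algFst L).toPseudo = a.toPseudo)
    (h₂ : z.comp (algSnd L).toPseudo = b.toPseudo) :
    ∃ s : StrictHom W (alg L), s.toPseudo = z := by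
  have c₁ := PseudoHom.cst_eq_of_toPseudo_eq h₁
  have c₂ := PseudoHom.cst_eq_of_toPseudo_eq h₂
  have e₁ : T.map (z.hom ≫ L.fst) ≫ A.str = W.str ≫ z.hom ≫ L.fst := by
    rw [show z.hom ≫ L.fst = a.hom from congr(PseudoHom.hom $h₁)]
    exact a.comm
  have e₂ : T.map (z.hom ≫ L.snd) ≫ B.str = W.str ≫ z.hom ≫ L.snd := by
    rw [show z.hom ≫ L.snd = b.hom from congr(PseudoHom.hom $h₂)]
    exact b.comm
  simp [eqToHom_comp_iff, comp_eqToHom_iff] at c₁ c₂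
  -- Both projections of the constraint are identities, so this interchange says that its source and
  -- target 1-cells agree on `cell`; hence they are equal.
  have h := whisker_exchange z.cst.hom L.cell
  have hz : T.map z.hom ≫ str L = W.str ≫ z.hom := by
    refine L.hom_ext ?_ ?_ ?_
    · rw [Category.assoc, str_fst, ← Category.assoc, ← T.map_comp, e₁, Category.assoc]
    · rw [Category.assoc, str_snd, ← Category.assoc, ← T.map_comp, e₂, Category.assoc]
    · simp [c₁, c₂, eqToHom_comp_iff, comp_eqToHom_iff] at h
      simp [h]
  exact z.exists_toPseudo_eq hz (L.hom_ext₂ (by simp [c₁]) (by simp [c₂]))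

end ArrowLimit

/-! ### From classifiers to universal pseudomorphisms. -/

/-- The strict morphism out of a free algebra that extends a 1-cell. -/
abbrev freeLift {C : K} {X : T.Alg} (R : C ⟶ X.carrier) : StrictHom (T.free C) X where
  hom := T.map R ≫ X.str
  comm := by rw [T.map_comp, Category.assoc, X.assoc, ← Category.assoc, T.μ_comm, Category.assoc]

theorem η_freeLift {C : K} {X : T.Alg} (R : C ⟶ X.carrier) :
    T.η C ≫ (freeLift R).hom = R := by
  rw [← Category.assoc, ← T.η_comm, Category.assoc, X.unit, Category.comp_id]

theorem free_hom_ext {C : K} {X : T.Alg} {s t : StrictHom (T.free C) X}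
    (h : T.η C ≫ s.hom = T.η C ≫ t.hom) : s = t := by
  have key (s : StrictHom (T.free C) X) : s.hom = T.map (T.η C ≫ s.hom) ≫ X.str := by
    rw [T.map_comp, Category.assoc, s.comm, ← Category.assoc, T.right_unit, Category.id_comp]
  ext
  rw [key s, key t, h]

namespace PseudomorphismClassifier

variable (c : T.PseudomorphismClassifier)

/-- The unit of a pseudomorphism classifier. -/
abbrev ζ (X : T.Alg) : PseudoHom X (c.Q.obj X).toAlg := c.adj.unit X

theorem exists_strict {X Y : T.Alg} (f : PseudoHom X Y) :
    ∃ s : StrictHom (c.Q.obj X).toAlg Y, (c.ζ X).comp s.toPseudo = f := by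
  let Y' : T.AlgS := ⟨Y⟩
  let f' : X ⟶ T.incl.obj Y' := f
  refine ⟨(c.Q.map f' ≫ c.adj.counit Y' : c.Q.obj X ⟶ Y'), ?_⟩
  have h₁ : f' ≫ c.adj.unit _ = c.adj.unit X ≫ T.incl.map (c.Q.map f') :=
    c.adj.unit_natural.naturality f'
  have h₂ := c.adj.right_triangle Y'
  change c.adj.unit X ≫ T.incl.map (c.Q.map f' ≫ c.adj.counit Y') = f'
  rw [T.incl.map_comp, ← Category.assoc, ← h₁, Category.assoc, h₂, Category.comp_id]

theorem strict_ext {X Y : T.Alg} {s t : StrictHom (c.Q.obj X).toAlg Y}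
    (h : (c.ζ X).comp s.toPseudo = (c.ζ X).comp t.toPseudo) : s = t := by
  let Y' : T.AlgS := ⟨Y⟩
  have key (s : c.Q.obj X ⟶ Y') :
      s = c.Q.map (c.adj.unit X ≫ T.incl.map s) ≫ c.adj.counit Y' := by
    have h₁ : c.Q.map (T.incl.map s) ≫ c.adj.counit Y' = c.adj.counit _ ≫ s :=
      c.adj.counit_natural.naturality s
    rw [c.Q.map_comp, Category.assoc, h₁, ← Category.assoc, c.adj.left_triangle, Category.id_comp]
  replace h : c.adj.unit X ≫ T.incl.map (show c.Q.obj X ⟶ Y' from s) =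
    c.adj.unit X ≫ T.incl.map (show c.Q.obj X ⟶ Y' from t) := h
  exact (key s).trans ((congrArg (fun p => c.Q.map p ≫ c.adj.counit Y') h).trans (key t).symm)

open Limits in
/-- The universal pseudomorphism of a 1-cell, as a pushout in the category of algebras and strict
morphisms. -/
theorem nonempty_universalPseudomorphism (c : T.PseudomorphismClassifier)
    [HasPushouts T.AlgS] {C C' : K} (φ : C ⟶ C') :
    Nonempty (T.UniversalPseudomorphism φ) := by
  let F : T.AlgS := ⟨T.free C⟩
  let F' : T.AlgS := ⟨T.free C'⟩
  -- The strict map that agrees with `ζ` on generators. Gluing along it makes `ζ ≫ inl`, restricted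
  -- along `η`, factor through `φ`.
  let m : F ⟶ c.Q.obj (T.free C) := freeLift (T.η C ≫ (c.ζ (T.free C)).hom)
  let t : F ⟶ F' := T.freeMap φ
  let inl : StrictHom (c.Q.obj (T.free C)).toAlg (pushout m t).toAlg := pushout.inl m t
  let inr : StrictHom (T.free C') (pushout m t).toAlg := pushout.inr m t
  have hm : T.η C ≫ StrictHom.hom m = T.η C ≫ (c.ζ (T.free C)).hom := η_freeLift _
  have cond : StrictHom.hom m ≫ inl.hom = T.map φ ≫ inr.hom :=
    congrArg StrictHom.hom (pushout.condition (f := m) (g := t))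
  refine ⟨⟨(pushout m t).toAlg, (c.ζ (T.free C)).comp inl.toPseudo, T.η C' ≫ inr.hom, ?_, ?_⟩⟩
  · change T.η C ≫ (c.ζ (T.free C)).hom ≫ inl.hom = _
    rw [← Category.assoc, ← hm, Category.assoc, cond, ← Category.assoc, ← T.η_comm, Category.assoc]
  · intro X Y f
    constructor
    · rintro ⟨⟨j, k⟩, h⟩ ⟨⟨j', k'⟩, h'⟩ e
      have e₁ : T.η C ≫ j.hom = T.η C ≫ j'.hom := congr(($e).1.1)
      have e₂ : (T.η C' ≫ inr.hom) ≫ k.hom = (T.η C' ≫ inr.hom) ≫ k'.hom := congr(($e).1.2)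
      obtain rfl := free_hom_ext e₁
      rw [Category.assoc, Category.assoc] at e₂
      have e₃ : inl.comp k = inl.comp k' := c.strict_ext (by
        rw [StrictHom.toPseudo_comp, StrictHom.toPseudo_comp, ← PseudoHom.assoc, ← PseudoHom.assoc]
        exact h.symm.trans h')
      have e₄ : inr.comp k = inr.comp k' := free_hom_ext e₂
      obtain rfl : k = k' :=
        pushout.hom_ext (f := m) (g := t) (W := (⟨Y⟩ : T.AlgS)) e₃ e₄
      rfl
    · rintro ⟨⟨R, S⟩, h⟩
      obtain ⟨k₁, hk₁⟩ := c.exists_strict ((freeLift R).toPseudo.comp f)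
      -- Out of a free algebra the cocone condition need only hold on generators, where it is the
      -- given square `R ≫ f = φ ≫ S`.
      have e : StrictHom.comp m k₁ = StrictHom.comp t (freeLift S) := free_hom_ext (by
        have h₁ : (c.ζ (T.free C)).hom ≫ k₁.hom = (freeLift R).hom ≫ f.hom :=
          congrArg PseudoHom.hom hk₁
        change T.η C ≫ StrictHom.hom m ≫ k₁.hom = T.η C ≫ T.map φ ≫ (freeLift S).hom
        rw [← Category.assoc, hm, Category.assoc, h₁, ← Category.assoc, η_freeLift,
          ← Category.assoc, ← T.η_comm, Category.assoc, η_freeLift]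
        exact h)
      let k : StrictHom (pushout m t).toAlg Y := pushout.desc (W := (⟨Y⟩ : T.AlgS)) k₁ (freeLift S) e
      have hl : inl.comp k = k₁ := pushout.inl_desc (W := (⟨Y⟩ : T.AlgS)) k₁ (freeLift S) e
      have hr : inr.comp k = freeLift S := pushout.inr_desc (W := (⟨Y⟩ : T.AlgS)) k₁ (freeLift S) e
      refine ⟨⟨(freeLift R, k), ?_⟩, Subtype.ext (Prod.ext (η_freeLift R) ?_)⟩
      · change (freeLift R).toPseudo.comp f = ((c.ζ (T.free C)).comp inl.toPseudo).comp k.toPseudo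
        rw [PseudoHom.assoc, ← StrictHom.toPseudo_comp, hl, hk₁]
      · change (T.η C' ≫ inr.hom) ≫ k.hom = S
        rw [Category.assoc]
        exact congr(T.η C' ≫ StrictHom.hom $hr).trans (η_freeLift S)

end PseudomorphismClassifier

end TwoMonad

/-! ### Every algebra as a coequalizer of free algebras in `T-Alg`. -/

theorem whiskerLeft_heq {K : Type u} [Bicategory.{w, v} K] {X Y Z : K} (p : X ⟶ Y) {f g f' g' : Y ⟶ Z} (hf : f = f') (hg : g = g')
    {θ : f ⟶ g} {θ' : f' ⟶ g'} (h : θ ≍ θ') : p ◁ θ ≍ p ◁ θ' := by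
  subst hf hg h
  rfl

namespace TwoMonad

variable {K : Type u} [Bicategory.{w, v} K] [Bicategory.Strict K] {T : TwoMonad K}

attribute [local simp] PrelaxFunctor.map₂_eqToHom StrictPseudofunctor.mapComp_eq_eqToIso
  Strict.leftUnitor_eqToIso Strict.rightUnitor_eqToIso Strict.associator_eqToIso

/-- The structure morphism of an algebra, as a strict morphism from the free algebra. -/
abbrev Alg.strHom (X : T.Alg) : StrictHom (T.free X.carrier) X := ⟨X.str, X.assoc⟩

theorem PseudoHom.whiskerLeft_cst {X Y Z : T.Alg} (u : StrictHom X Y) (z : PseudoHom Y Z) :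
    T.map u.hom ◁ z.cst.hom = eqToHom (by rw [T.map_comp, Category.assoc]) ≫
      (u.toPseudo.comp z).cst.hom ≫ eqToHom ((Category.assoc _ _ _).symm.trans
        ((congrArg (· ≫ z.hom) u.comm.symm).trans (Category.assoc _ _ _))) := by
  simp

theorem PseudoHom.whiskerLeft_cst_heq {X Y Y' Z : T.Alg} {u : StrictHom X Y} {u' : StrictHom X Y'}
    {z : PseudoHom Y Z} {z' : PseudoHom Y' Z} (h : u.toPseudo.comp z = u'.toPseudo.comp z') :
    T.map u.hom ◁ z.cst.hom ≍ T.map u'.hom ◁ z'.cst.hom := by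
  rw [z.whiskerLeft_cst, z'.whiskerLeft_cst, eqToHom_comp_heq_iff, comp_eqToHom_heq_iff,
    heq_eqToHom_comp_iff, heq_comp_eqToHom_iff, h]

theorem heq_iff_eq_eqToHom_comp {C : Type u} [Category.{v} C] {X Y X' Y' : C} (hX : X = X')
    (hY : Y = Y') (f : X ⟶ Y) (g : X' ⟶ Y') :
    f ≍ g ↔ f = eqToHom hX ≫ g ≫ eqToHom hY.symm := by
  subst hX hY
  simp

theorem whiskerLeft_whiskerLeft_heq {X Y Y' Z W : K} {p : X ⟶ Y} {q : Y ⟶ Z} {p' : X ⟶ Y'}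
    {q' : Y' ⟶ Z} (h : p ≫ q = p' ≫ q') {f g : Z ⟶ W} (θ : f ⟶ g) : p ◁ q ◁ θ ≍ p' ◁ q' ◁ θ := by
  simp [whiskerLeft_whiskerLeft_of_eq h]

theorem whiskerLeft_whiskerLeft_heq_self {X Y Z : K} {p : X ⟶ Y} {q : Y ⟶ X}
    (h : p ≫ q = 𝟙 X) {f g : X ⟶ Z} (θ : f ⟶ g) : p ◁ q ◁ θ ≍ θ := by
  simp [whiskerLeft_whiskerLeft_of_eq_id h]

/-- The structure morphism of an algebra is an epimorphism in `T-Alg`. -/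
theorem strHom_comp_injective {X Y : T.Alg} {h h' : PseudoHom X Y}
    (e : X.strHom.toPseudo.comp h = X.strHom.toPseudo.comp h') : h = h' := by
  have e₁ : X.str ≫ h.hom = X.str ≫ h'.hom := congr(PseudoHom.hom $e)
  have e₂ : h.hom = h'.hom := by
    rw [← Category.id_comp h.hom, ← X.unit, Category.assoc, e₁, ← Category.assoc, X.unit,
      Category.id_comp]
  have e₃ := PseudoHom.whiskerLeft_cst_heq e
  obtain ⟨h, c, _, _⟩ := h
  obtain ⟨h', c', _, _⟩ := h'
  obtain rfl : h = h' := e₂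
  obtain rfl : c = c' := by
    ext
    -- `T x` is split by `T η`, so whiskering with it is injective on 2-cells.
    have e₄ (θ : T.map h ≫ Y.str ⟶ X.str ≫ h) := whiskerLeft_whiskerLeft_of_eq_id
      (p := T.map (T.η X.carrier)) (q := T.map X.str) (by rw [← T.map_comp, X.unit, T.map_id]) θ
    have e₅ := congr(T.map (T.η X.carrier) ◁ $(eq_of_heq e₃))
    rw [e₄, e₄] at e₅
    exact (cancel_mono _).1 ((cancel_epi _).1 e₅)
  rfl

/-- In `K` the fork `μ, T x, x` is split by `η`, and `T` preserves the splitting. So `g` descends to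
`η ≫ g`, and its constraint descends by whiskering with `T η`. The pseudomorphism `g` is unbundled
so that the structure map of its source is literally `T.μ`. -/
theorem exists_pseudoHom_of_coequalizes {X Y : T.Alg} (g : T.obj X.carrier ⟶ Y.carrier)
    (c : T.map g ≫ Y.str ≅ T.μ X.carrier ≫ g)
    (hu : T.η (T.obj X.carrier) ◁ c.hom = eqToHom (by exact unit_src (X := T.free X.carrier) g))
    (hm : T.map₂ c.hom ▷ Y.str ≫ eqToHom (by exact mult_mid (X := T.free X.carrier) g) ≫
      T.map (T.μ X.carrier) ◁ c.hom = eqToHom (by exact mult_src (X := T.free X.carrier) g) ≫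
        T.μ (T.obj X.carrier) ◁ c.hom ≫ eqToHom (by exact (mult_tgt (X := T.free X.carrier) g).symm))
    (e : T.μ X.carrier ≫ g = T.map X.str ≫ g)
    (e₂ : T.map (T.μ X.carrier) ◁ c.hom ≍ T.map (T.map X.str) ◁ c.hom) :
    ∃ h : PseudoHom X Y, X.str ≫ h.hom = g ∧ T.map X.str ◁ h.cst.hom ≍ c.hom := by
  have e₁ : X.str ≫ T.η X.carrier ≫ g = g := by
    rw [← Category.assoc, T.η_comm, Category.assoc, ← e, ← Category.assoc, T.left_unit,
      Category.id_comp]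
  let c' : T.map (T.η X.carrier ≫ g) ≫ Y.str ≅ X.str ≫ T.η X.carrier ≫ g :=
    eqToIso (by rw [T.map_comp, Category.assoc]) ≪≫ whiskerLeftIso (T.map (T.η X.carrier)) c ≪≫
      eqToIso (by rw [e₁, ← Category.assoc, T.right_unit, Category.id_comp])
  have hc : T.map X.str ◁ c'.hom ≍ c.hom := by
    -- Naturality of `η` moves `T x` inside, `e₂` replaces it by `μ`, and the unit law cancels `μ`.
    have e₃ : T.map X.str ◁ T.map (T.η X.carrier) ◁ c.hom ≍ c.hom :=
      (whiskerLeft_whiskerLeft_heq (by rw [← T.map_comp, T.η_comm, T.map_comp]) _).trans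
        ((whiskerLeft_heq (T.map (T.η (T.obj X.carrier))) (by
            rw [← Category.assoc, ← T.map_comp, ← e, T.map_comp, Category.assoc]) (by
            rw [← Category.assoc, T.μ_comm, Category.assoc, ← e, ← Category.assoc, ← T.assoc,
              Category.assoc]) e₂.symm).trans
          (whiskerLeft_whiskerLeft_heq_self (by rw [← T.map_comp, T.left_unit, T.map_id]) _))
    simpa [c'] using e₃
  refine ⟨⟨T.η X.carrier ≫ g, c', ?_, ?_⟩, e₁, hc⟩
  · simp [c', η_whiskerLeft_map, hu]
  -- The multiplication axiom is that of `g` whiskered with `T T η`, which is a section of `T μ`.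
  · have e₃ : T.map (T.map (T.η X.carrier)) ≫ T.map (T.μ X.carrier) = 𝟙 _ := by
      rw [← T.map_comp, T.right_unit, T.map_id]
    replace hc := hc.trans (whiskerLeft_whiskerLeft_heq_self e₃ c.hom).symm
    rw [heq_iff_eq_eqToHom_comp (by
        rw [← Category.assoc, ← T.map_comp, e₁, ← Category.assoc (T.map (T.map _)), e₃,
          Category.id_comp])
      (by rw [e₁, ← e, ← Category.assoc (T.map (T.map _)), e₃, Category.id_comp])] at hc
    replace hm := congr(T.map (T.map (T.η X.carrier)) ◁ $hm)
    rw [hc]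
    simp at hm
    simp [c', μ_whiskerLeft_map, reassoc_of% hm]

/-- The structure morphism of an algebra `(X, x)` is a coequalizer of `μ` and `T x` in `T-Alg`. -/
theorem exists_strHom_comp {X Y : T.Alg} (g : PseudoHom (T.free X.carrier) Y)
    (hg : (T.freeMul X.carrier).toPseudo.comp g = (T.freeMap X.str).toPseudo.comp g) :
    ∃ h : PseudoHom X Y, X.strHom.toPseudo.comp h = g := by
  obtain ⟨h, e, hc⟩ := exists_pseudoHom_of_coequalizes g.hom g.cst g.unit g.mult
    congr(PseudoHom.hom $hg) (PseudoHom.whiskerLeft_cst_heq hg)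
  refine ⟨h, PseudoHom.ext_of_eqToHom e ?_⟩
  rw [← heq_iff_eq_eqToHom_comp _ congr((T.free X.carrier).str ≫ $e)]
  simpa using hc

end TwoMonad

/-! ### From two-dimensional universal arrows to 2-adjunctions. -/

section Adjunction

variable {A : Type u₁} [Bicategory.{w₁, v₁} A] {B : Type u₂}
  [Bicategory.{w₂, v₂} B]

attribute [local simp] PrelaxFunctor.map₂_eqToHom StrictPseudofunctor.mapComp_eq_eqToIso
  Strict.leftUnitor_eqToIso Strict.rightUnitor_eqToIso Strict.associator_eqToIso

/-- A family of universal arrows `ζ X : X ⟶ R (L X)`, in the 2-dimensional sense: composition with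
`ζ X` induces isomorphisms of categories `B(L X, Y) ≅ A(X, R Y)`. -/
structure UniversalArrows (R : StrictPseudofunctor B A) where
  obj : A → B
  ζ : ∀ X, X ⟶ R.obj (obj X)
  exists_lift : ∀ {X Y} (f : X ⟶ R.obj Y), ∃ s : obj X ⟶ Y, ζ X ≫ R.map s = f
  hom_ext : ∀ {X Y} {s t : obj X ⟶ Y}, ζ X ≫ R.map s = ζ X ≫ R.map t → s = t
  exists_lift₂ : ∀ {X Y} {s t : obj X ⟶ Y} (α : ζ X ≫ R.map s ⟶ ζ X ≫ R.map t),
    ∃ β : s ⟶ t, ζ X ◁ R.map₂ β = α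
  hom_ext₂ : ∀ {X Y} {s t : obj X ⟶ Y} {β γ : s ⟶ t}, ζ X ◁ R.map₂ β = ζ X ◁ R.map₂ γ → β = γ

namespace UniversalArrows

variable {R : StrictPseudofunctor B A} (U : UniversalArrows R)

/-- The 1-cell induced by a universal arrow. -/
noncomputable def lift {X : A} {Y : B} (f : X ⟶ R.obj Y) : U.obj X ⟶ Y := (U.exists_lift f).choose

theorem ζ_lift {X : A} {Y : B} (f : X ⟶ R.obj Y) : U.ζ X ≫ R.map (U.lift f) = f :=
  (U.exists_lift f).choose_spec

/-- The 2-cell induced by a universal arrow. -/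
noncomputable def lift₂ {X : A} {Y : B} {s t : U.obj X ⟶ Y}
    (α : U.ζ X ≫ R.map s ⟶ U.ζ X ≫ R.map t) : s ⟶ t :=
  (U.exists_lift₂ α).choose

theorem ζ_lift₂ {X : A} {Y : B} {s t : U.obj X ⟶ Y} (α : U.ζ X ≫ R.map s ⟶ U.ζ X ≫ R.map t) :
    U.ζ X ◁ R.map₂ (U.lift₂ α) = α :=
  (U.exists_lift₂ α).choose_spec

/-- The action of the left adjoint on 1-cells. -/
noncomputable def map {X Y : A} (f : X ⟶ Y) : U.obj X ⟶ U.obj Y := U.lift (f ≫ U.ζ Y)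

theorem ζ_map {X Y : A} (f : X ⟶ Y) : U.ζ X ≫ R.map (U.map f) = f ≫ U.ζ Y := U.ζ_lift _

/-- The action of the left adjoint on 2-cells. -/
noncomputable def map₂ {X Y : A} {f g : X ⟶ Y} (θ : f ⟶ g) : U.map f ⟶ U.map g :=
  U.lift₂ (eqToHom (U.ζ_map f) ≫ θ ▷ U.ζ Y ≫ eqToHom (U.ζ_map g).symm)

theorem ζ_map₂ {X Y : A} {f g : X ⟶ Y} (θ : f ⟶ g) : U.ζ X ◁ R.map₂ (U.map₂ θ) =
    eqToHom (U.ζ_map f) ≫ θ ▷ U.ζ Y ≫ eqToHom (U.ζ_map g).symm :=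
  U.ζ_lift₂ _

/-- The counit of the induced 2-adjunction. -/
noncomputable def counit (Y : B) : U.obj (R.obj Y) ⟶ Y := U.lift (𝟙 _)

theorem ζ_counit (Y : B) : U.ζ (R.obj Y) ≫ R.map (U.counit Y) = 𝟙 _ := U.ζ_lift _

variable [Bicategory.Strict A]

theorem ζ_whiskerLeft_map {X Y : A} {Z : A} (p : X ⟶ Y) {f g : R.obj (U.obj Y) ⟶ Z}
    (θ : f ⟶ g) : U.ζ X ◁ R.map (U.map p) ◁ θ =
      eqToHom (by rw [← Category.assoc, U.ζ_map, Category.assoc]) ≫ p ◁ U.ζ Y ◁ θ ≫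
        eqToHom (by rw [← Category.assoc, ← U.ζ_map, Category.assoc]) :=
  TwoMonad.whiskerLeft_whiskerLeft_of_eq (U.ζ_map p) θ

theorem ζ_whiskerLeft_map₂ {X Y Z : A} {f g : X ⟶ Y} (θ : f ⟶ g) (h : R.obj (U.obj Y) ⟶ Z) :
    U.ζ X ◁ R.map₂ (U.map₂ θ) ▷ h =
      eqToHom (by rw [← Category.assoc, U.ζ_map, Category.assoc]) ≫ θ ▷ U.ζ Y ▷ h ≫
        eqToHom (by rw [← Category.assoc, U.ζ_map]) := by
  have := congr($(U.ζ_map₂ θ) ▷ h)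
  simp [eqToHom_comp_iff, comp_eqToHom_iff] at this
  simp [this]

variable [Bicategory.Strict B]

/-- The 2-functor left adjoint to `R` induced by universal arrows. -/
noncomputable def leftAdjoint : StrictPseudofunctor A B :=
  StrictPseudofunctor.mk''
    { obj := U.obj
      map := U.map
      map₂ := U.map₂
      -- Each law is verified after restriction along `ζ`, where it becomes the corresponding law in
      -- `A`.
      map₂_id f := U.hom_ext₂ (by simp [ζ_map₂])
      map₂_comp θ χ := U.hom_ext₂ (by simp [ζ_map₂])
      map_id X := U.hom_ext (by rw [ζ_map, R.map_id, Category.id_comp, Category.comp_id])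
      map_comp f g := U.hom_ext (by
        rw [ζ_map, R.map_comp, ← Category.assoc (U.ζ _), ζ_map, Category.assoc, Category.assoc,
          ζ_map])
      map₂_whisker_left f g g' θ := U.hom_ext₂ (by
        simp [ζ_map₂, ζ_whiskerLeft_map])
      map₂_whisker_right {_ _ _ f f'} θ h := U.hom_ext₂ (by
        have := TwoMonad.whiskerRight_whiskerRight_of_eq (U.ζ_map h) θ
        simp [ζ_map₂, ζ_whiskerLeft_map₂, this]) }

/-- The 2-adjunction induced by universal arrows. -/
noncomputable def adjunction : TwoAdjunction U.leftAdjoint R where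
  unit := U.ζ
  counit := U.counit
  unit_natural :=
    { naturality f := (U.ζ_map f).symm
      naturality₂ {X Y f g} θ := by
        have h : θ ▷ U.ζ Y = eqToHom (U.ζ_map f).symm ≫ U.ζ X ◁ R.map₂ (U.map₂ θ) ≫
            eqToHom (U.ζ_map g) := by
          simp [ζ_map₂]
        exact h }
  counit_natural := by
    have nat {X Y : B} (f : X ⟶ Y) : U.map (R.map f) ≫ U.counit Y = U.counit X ≫ f :=
      U.hom_ext (by
        rw [R.map_comp, ← Category.assoc, ζ_map, Category.assoc, ζ_counit, R.map_comp,
          ← Category.assoc, ζ_counit, Category.comp_id, Category.id_comp])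
    exact
    { naturality := nat
      naturality₂ {X Y f g} θ := by
        change U.map₂ (R.map₂ θ) ▷ U.counit Y = eqToHom (nat f) ≫ U.counit X ◁ θ ≫
          eqToHom (nat g).symm
        apply U.hom_ext₂
        have h₁ := TwoMonad.whiskerLeft_whiskerLeft_of_eq_id (U.ζ_counit X) (R.map₂ θ)
        have h₂ := TwoMonad.whiskerRight_whiskerRight_of_eq_id (U.ζ_counit Y) (R.map₂ θ)
        simp [ζ_whiskerLeft_map₂, h₁, h₂] }
  left_triangle X := U.hom_ext (by
    change U.ζ X ≫ R.map (U.map (U.ζ X) ≫ U.counit (U.obj X)) = U.ζ X ≫ R.map (𝟙 (U.obj X))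
    rw [R.map_comp, ← Category.assoc, ζ_map, Category.assoc, ζ_counit, R.map_id])
  right_triangle := U.ζ_counit

end UniversalArrows

end Adjunction

namespace TwoMonad

variable {K : Type u} [Bicategory.{w, v} K] [Bicategory.Strict K] {T : TwoMonad K}

attribute [local simp] PrelaxFunctor.map₂_eqToHom StrictPseudofunctor.mapComp_eq_eqToIso
  Strict.leftUnitor_eqToIso Strict.rightUnitor_eqToIso Strict.associator_eqToIso

/-! ### The two-dimensional universal property of classifiers. -/

namespace ArrowLimit

variable {Y : T.Alg} {inv : Prop} (L : ArrowLimit inv (PseudoHom.id Y).hom)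

/-- For a limit of an identity, the universal 2-cell between the two projections. -/
noncomputable def idCell : AlgTwoCell (algFst L).toPseudo (algSnd L).toPseudo where
  hom := eqToHom (Category.comp_id _).symm ≫ L.cell
  comm := by
    have h := (algCell L).comm
    simp [algCell] at h
    simp [h]

/-- This trades algebra 2-cells for pseudomorphisms into a limit of the identity, to which
one-dimensional universal properties apply. -/
theorem exists_idLift {W : T.Alg} {p q : PseudoHom W Y} (α : AlgTwoCell p q)
    (hα : inv → IsIso α.hom) :
    ∃ (z : PseudoHom W (alg L)) (h₁ : z.comp (algFst L).toPseudo = p)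
      (h₂ : z.comp (algSnd L).toPseudo = q), z.hom ◁ (idCell L).hom =
        eqToHom (by rw [← h₁]) ≫ α.hom ≫ eqToHom (by rw [← h₂]) := by
  let σ : AlgTwoCell (p.comp (PseudoHom.id Y)) q :=
    { hom := eqToHom (Category.comp_id _) ≫ α.hom
      comm := by simp [α.comm] }
  obtain ⟨z, h₁, h₂, hz⟩ := exists_algLift L p q σ (fun h => by
    have := hα h
    change IsIso (eqToHom _ ≫ α.hom)
    infer_instance)
  refine ⟨z, h₁, h₂, ?_⟩
  simp [idCell, hz, σ]

theorem id_hom_ext {W : T.Alg} {z z' : PseudoHom W (alg L)}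
    (h₁ : z.comp (algFst L).toPseudo = z'.comp (algFst L).toPseudo)
    (h₂ : z.comp (algSnd L).toPseudo = z'.comp (algSnd L).toPseudo)
    (hc : z.hom ◁ (idCell L).hom = eqToHom congr(PseudoHom.hom $h₁) ≫ z'.hom ◁ (idCell L).hom ≫
      eqToHom congr(PseudoHom.hom $h₂).symm) :
    z = z' := by
  refine alg_hom_ext L h₁ h₂ ?_
  simp [idCell, eqToHom_comp_iff] at hc
  simpa using hc

end ArrowLimit

/-- The 1-dimensional universal property of a pseudomorphism classifier `Z` of `X`. -/
structure IsClassifier {X Z : T.Alg} (ζ : PseudoHom X Z) : Prop where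
  exists_strict {Y : T.Alg} (f : PseudoHom X Y) : ∃ s : StrictHom Z Y, ζ.comp s.toPseudo = f
  strict_ext {Y : T.Alg} {s t : StrictHom Z Y} :
    ζ.comp s.toPseudo = ζ.comp t.toPseudo → s = t

namespace IsClassifier

variable {X Z Y : T.Alg} {ζ : PseudoHom X Z}

/-- Encode `α` as a pseudomorphism into the cotensor of `Y` with the free arrow. Its strict
factorization through `ζ`, whiskered with the universal cell, is `β`; its projections are `s` and
`t` by uniqueness. -/
theorem exists_cell (hζ : IsClassifier ζ) (L : ArrowLimit False (PseudoHom.id Y).hom) {s t : StrictHom Z Y}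
    (α : AlgTwoCell (ζ.comp s.toPseudo) (ζ.comp t.toPseudo)) :
    ∃ β : AlgTwoCell s.toPseudo t.toPseudo, ζ.hom ◁ β.hom = α.hom := by
  obtain ⟨z, h₁, h₂, hz⟩ := ArrowLimit.exists_idLift L α False.elim
  obtain ⟨b, rfl⟩ := hζ.exists_strict z
  obtain rfl : s = b.comp (ArrowLimit.algFst L) := hζ.strict_ext (by
    rw [StrictHom.toPseudo_comp, ← PseudoHom.assoc, h₁])
  obtain rfl : t = b.comp (ArrowLimit.algSnd L) := hζ.strict_ext (by
    rw [StrictHom.toPseudo_comp, ← PseudoHom.assoc, h₂])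
  let A : T.AlgS := ⟨Z⟩
  let B : T.AlgS := ⟨ArrowLimit.alg L⟩
  let C : T.AlgS := ⟨Y⟩
  refine ⟨whiskerLeft (B := T.AlgS) (a := A) (b := B) (c := C) b (ArrowLimit.idCell L), ?_⟩
  change ζ.hom ◁ b.hom ◁ (ArrowLimit.idCell L).hom = _
  simp at hz
  exact (cancel_mono _).1 ((cancel_epi _).1 hz)

/-- The source and target of `β` and `γ` are strict, so the morphisms into the cotensor that encode
them are strict as well; uniqueness of strict factorizations identifies these. -/
theorem cell_ext (hζ : IsClassifier ζ) (L : ArrowLimit False (PseudoHom.id Y).hom) {s t : StrictHom Z Y}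
    {β γ : AlgTwoCell s.toPseudo t.toPseudo} (h : ζ.hom ◁ β.hom = ζ.hom ◁ γ.hom) : β = γ := by
  obtain ⟨z, h₁, h₂, hz⟩ := ArrowLimit.exists_idLift L β False.elim
  obtain ⟨z', h₁', h₂', hz'⟩ := ArrowLimit.exists_idLift L γ False.elim
  obtain ⟨b, rfl⟩ := ArrowLimit.exists_toPseudo_eq L z h₁ h₂
  obtain ⟨b', rfl⟩ := ArrowLimit.exists_toPseudo_eq L z' h₁' h₂'
  obtain rfl : b = b' := hζ.strict_ext (by
    refine ArrowLimit.id_hom_ext L (by simp only [PseudoHom.assoc, h₁, h₁'])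
      (by simp only [PseudoHom.assoc, h₂, h₂']) ?_
    have k := congr(ζ.hom ◁ $hz)
    have k' := congr(ζ.hom ◁ $hz')
    simp [h] at k k'
    simp [k, k'])
  rw [hz] at hz'
  exact AlgTwoCell.ext ((cancel_mono _).1 ((cancel_epi _).1 hz'))

end IsClassifier

/-- Classifiers of all algebras assemble into a pseudomorphism classifier. -/
theorem nonempty_pseudomorphismClassifier
    (hK : ∀ X : K, Nonempty (ArrowLimit False (𝟙 X)))
    (h : ∀ X : T.Alg, ∃ (Z : T.Alg) (ζ : PseudoHom X Z), IsClassifier ζ) :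
    Nonempty T.PseudomorphismClassifier := by
  choose Q ζ hζ using h
  let U : UniversalArrows T.incl :=
    { obj X := ⟨Q X⟩
      ζ := ζ
      exists_lift {X Y} f := (hζ X).exists_strict (Y := Y.toAlg) f
      hom_ext {X Y} {s t} e := (hζ X).strict_ext (Y := Y.toAlg) e
      exists_lift₂ {X Y s t} α := by
        obtain ⟨L⟩ := hK Y.toAlg.carrier
        obtain ⟨β, hβ⟩ := (hζ X).exists_cell (Y := Y.toAlg) L α
        exact ⟨β, AlgTwoCell.ext hβ⟩
      hom_ext₂ {X Y s t β γ} e := by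
        obtain ⟨L⟩ := hK Y.toAlg.carrier
        exact (hζ X).cell_ext (Y := Y.toAlg) L congr(AlgTwoCell.hom $e) }
  exact ⟨⟨U.leftAdjoint, U.adjunction⟩⟩

/-! ### From universal pseudomorphisms to classifiers. -/

namespace UniversalPseudomorphism

variable {C C' : K} {φ : C ⟶ C'} (U : T.UniversalPseudomorphism φ) {X Y : T.Alg}

theorem κ_extend (f : PseudoHom X Y) (p : ArrowHom φ f.hom) :
    U.κ ≫ (U.extend f p).hom = p.1.2 :=
  congr(($((Equiv.ofBijective _ (U.universal f)).apply_symm_apply p)).1.2)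

theorem hom_extend (f : PseudoHom X Y) (p : ArrowHom φ f.hom) :
    U.hom.comp (U.extend f p).toPseudo = (freeLift p.1.1).toPseudo.comp f := by
  have h₁ := congr(($((Equiv.ofBijective _ (U.universal f)).apply_symm_apply p)).1.1)
  have h₂ := ((Equiv.ofBijective _ (U.universal f)).symm p).2
  have h₃ : ((Equiv.ofBijective _ (U.universal f)).symm p).1.1 = freeLift p.1.1 :=
    free_hom_ext (h₁.trans (η_freeLift p.1.1).symm)
  rw [h₃] at h₂
  exact h₂.symm

theorem freeLift_η : freeLift (X := T.free C) (T.η C) = StrictHom.id (T.free C) :=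
  StrictHom.ext (T.right_unit C)

/-- The universal property for squares that start with the identity of the free algebra. -/
theorem hom_extend_η (f : PseudoHom (T.free C) Y) (S : C' ⟶ Y.carrier)
    (h : T.η C ≫ f.hom = φ ≫ S) :
    U.hom.comp (U.extend f ⟨(T.η C, S), h⟩).toPseudo = f := by
  rw [hom_extend, freeLift_η]
  exact f.id_comp

/-- Paired with the identity of `T C`, both `s` and `t` are morphisms of arrows from `U.hom` to
`U.hom ≫ s`, so the injectivity in `universal` applies. -/
theorem strict_ext {s t : StrictHom U.obj Y}
    (h : U.hom.comp s.toPseudo = U.hom.comp t.toPseudo) (hκ : U.κ ≫ s.hom = U.κ ≫ t.hom) :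
    s = t := by
  have e := (U.universal (U.hom.comp s.toPseudo)).1
    (a₁ := ⟨(StrictHom.id _, s), PseudoHom.id_comp _⟩)
    (a₂ := ⟨(StrictHom.id _, t), (PseudoHom.id_comp _).trans h⟩)
    (Subtype.ext (Prod.ext rfl hκ))
  exact congr(($e).1.2)

/-- For `φ = 1` the 1-cell `κ` equals `η ≫ hom`, so agreement on `κ` is automatic. -/
theorem strict_ext_of_id (V : T.UniversalPseudomorphism (𝟙 C)) {s t : StrictHom V.obj Y}
    (h : V.hom.comp s.toPseudo = V.hom.comp t.toPseudo) : s = t :=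
  V.strict_ext h (by
    rw [← Category.id_comp V.κ, ← V.comm, Category.assoc, Category.assoc]
    exact congr(T.η C ≫ PseudoHom.hom $h))

end UniversalPseudomorphism

namespace UniversalPseudomorphisms

variable (U : T.UniversalPseudomorphisms)

/-- Over `1_C` the component `S` of a square is forced to be `η ≫ f`, leaving only the
pseudomorphism `f` as data. -/
theorem isClassifier_tilde (C : K) : IsClassifier (U.tilde C) where
  exists_strict f := ⟨_, (U.univ (𝟙 C)).hom_extend_η f (T.η C ≫ f.hom) (Category.id_comp _).symm⟩
  strict_ext h := (U.univ (𝟙 C)).strict_ext_of_id h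

theorem tilde_mapP {C C' : K} (f : PseudoHom (T.free C) (T.free C')) :
    (U.tilde C).comp (U.mapP f).toPseudo = f.comp (U.tilde C') :=
  (U.univ (𝟙 C)).hom_extend_η _ _ _

open Limits in
/-- A coequalizer of the `P`-free pair of an algebra is a classifier of it. -/
theorem exists_isClassifier (hU : U.HasCoequalizersOfPFreePairs) (X : T.Alg) :
    ∃ (Z : T.Alg) (ζ : PseudoHom X Z), IsClassifier ζ := by
  let A : T.AlgS := ⟨U.P (T.obj X.carrier)⟩
  let B : T.AlgS := ⟨U.P X.carrier⟩
  let a : A ⟶ B := U.mapP (T.freeMul X.carrier).toPseudo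
  let b : A ⟶ B := U.mapP (T.freeMap X.str).toPseudo
  have : HasCoequalizer a b := hU X
  let Z : T.Alg := (coequalizer a b).toAlg
  let q : StrictHom (U.P X.carrier) Z := coequalizer.π a b
  have hq : (U.mapP (T.freeMul X.carrier).toPseudo).comp q =
      (U.mapP (T.freeMap X.str).toPseudo).comp q := coequalizer.condition a b
  have hx : (T.freeMul X.carrier).comp X.strHom = (T.freeMap X.str).comp X.strHom :=
    StrictHom.ext X.assoc.symm
  -- `tilde` carries `μ` and `T x` to the `P`-free pair, which `q` coequalizes; so `tilde ≫ q`
  -- descends along `x` to `ζ`.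
  obtain ⟨ζ, hζ⟩ := exists_strHom_comp ((U.tilde X.carrier).comp q.toPseudo) (by
    rw [← PseudoHom.assoc, ← PseudoHom.assoc, ← U.tilde_mapP, ← U.tilde_mapP, PseudoHom.assoc,
      PseudoHom.assoc, ← StrictHom.toPseudo_comp, ← StrictHom.toPseudo_comp, hq])
  refine ⟨Z, ζ, fun {Y} f => ?_, fun {Y s t} h => ?_⟩
  · obtain ⟨k, hk⟩ := (U.isClassifier_tilde X.carrier).exists_strict (X.strHom.toPseudo.comp f)
    -- Tested on `tilde`, this is `μ ≫ x = T x ≫ x` followed by `f`.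
    have e : StrictHom.comp (U.mapP (T.freeMul X.carrier).toPseudo) k =
        StrictHom.comp (U.mapP (T.freeMap X.str).toPseudo) k :=
      (U.isClassifier_tilde _).strict_ext (by
        rw [StrictHom.toPseudo_comp, StrictHom.toPseudo_comp, ← PseudoHom.assoc,
          ← PseudoHom.assoc, U.tilde_mapP, U.tilde_mapP, PseudoHom.assoc, PseudoHom.assoc, hk,
          ← PseudoHom.assoc, ← PseudoHom.assoc, ← StrictHom.toPseudo_comp,
          ← StrictHom.toPseudo_comp, hx])
    let s : StrictHom Z Y := coequalizer.desc (W := (⟨Y⟩ : T.AlgS)) k e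
    have hs : q.comp s = k := coequalizer.π_desc (f := a) (g := b) (W := (⟨Y⟩ : T.AlgS)) k e
    refine ⟨s, strHom_comp_injective ?_⟩
    rw [← PseudoHom.assoc, hζ, PseudoHom.assoc, ← StrictHom.toPseudo_comp, hs, hk]
  · have e : q.comp s = q.comp t := (U.isClassifier_tilde _).strict_ext (by
      rw [StrictHom.toPseudo_comp, StrictHom.toPseudo_comp, ← PseudoHom.assoc, ← PseudoHom.assoc,
        ← hζ, PseudoHom.assoc, PseudoHom.assoc, h])
    exact coequalizer.hom_ext (f := a) (g := b) (W := (⟨Y⟩ : T.AlgS)) e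

end UniversalPseudomorphisms

/-! ### The unit and counit of a classifier form an adjoint surjective equivalence. -/

/-- An algebra 2-cell whose underlying 2-cell is invertible, as an isomorphism in `T-Alg`. -/
noncomputable def AlgTwoCell.isoMk {X Y : T.Alg} {f g : X ⟶ Y}
    (α : AlgTwoCell (show PseudoHom X Y from f) g) (hα : IsIso α.hom) : f ≅ g where
  hom := α
  inv := .ofInv (asIso α.hom) α.comm
  hom_inv_id := AlgTwoCell.ext (IsIso.hom_inv_id α.hom)
  inv_hom_id := AlgTwoCell.ext (IsIso.inv_hom_id α.hom)

/-- An algebra 2-cell whose underlying 2-cell is invertible, as an isomorphism in `T-Alg_s`. -/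
noncomputable def AlgTwoCell.isoMkStrict {X Y : T.AlgS} {f g : X ⟶ Y}
    (α : AlgTwoCell (StrictHom.toPseudo f) (StrictHom.toPseudo g)) (hα : IsIso α.hom) : f ≅ g where
  hom := α
  inv := AlgTwoCell.ofInv (asIso α.hom) α.comm
  hom_inv_id := AlgTwoCell.ext (IsIso.hom_inv_id α.hom)
  inv_hom_id := AlgTwoCell.ext (IsIso.inv_hom_id α.hom)

namespace PseudomorphismClassifier

variable (c : T.PseudomorphismClassifier)

/-- The counit of a pseudomorphism classifier. -/
abbrev δ (Y : T.AlgS) : StrictHom (c.Q.obj Y.toAlg).toAlg Y.toAlg := c.adj.counit Y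

/-- The identity 2-cell on `ζ` induces a pseudomorphism `d` from `Y` to the pseudolimit of `ζ`. Its
strict transpose `k` has projections `δ` and `1` by uniqueness, so the universal cell whiskered with
`k` is `Θ`. As `ζ ≫ k = d`, whiskering `Θ` with `ζ` returns the identity that defined `d`. -/
theorem exists_isAdjointSurjectiveEquivalence (Y : T.AlgS)
    (L : ArrowLimit True (c.ζ Y.toAlg).hom) :
    ∃ Θ, IsAdjointSurjectiveEquivalence
      (c.adj.unit (T.incl.obj Y)) (T.incl.map (c.adj.counit Y)) Θ := by
  have tri : (c.ζ Y.toAlg).comp (c.δ Y).toPseudo = PseudoHom.id Y.toAlg :=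
    c.adj.right_triangle Y
  obtain ⟨d, h₁, h₂, hd⟩ := ArrowLimit.exists_algLift L (PseudoHom.id Y.toAlg) (c.ζ Y.toAlg)
    (eqToHom (C := Y.toAlg ⟶ (c.Q.obj Y.toAlg).toAlg) (PseudoHom.id_comp _)) (fun _ => by
      rw [AlgTwoCell.eqToHom_hom]
      infer_instance)
  rw [AlgTwoCell.eqToHom_hom] at hd
  simp at hd
  obtain ⟨k, rfl⟩ := c.exists_strict d
  have k₁ : k.comp (ArrowLimit.algFst L) = c.δ Y := c.strict_ext (by
    rw [StrictHom.toPseudo_comp, ← PseudoHom.assoc, h₁, tri])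
  have k₂ : k.comp (ArrowLimit.algSnd L) = StrictHom.id _ := c.strict_ext (by
    rw [StrictHom.toPseudo_comp, ← PseudoHom.assoc, h₂, StrictHom.toPseudo_id, PseudoHom.comp_id])
  let Z : T.Alg := (c.Q.obj Y.toAlg).toAlg
  let k' : Z ⟶ ArrowLimit.alg L := k.toPseudo
  let u : ArrowLimit.alg L ⟶ Y.toAlg := (ArrowLimit.algFst L).toPseudo
  let v : ArrowLimit.alg L ⟶ Z := (ArrowLimit.algSnd L).toPseudo
  let z : Y.toAlg ⟶ Z := c.ζ Y.toAlg
  let δ : Z ⟶ Y.toAlg := (c.δ Y).toPseudo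
  have hδ : k' ≫ u = δ := (StrictHom.toPseudo_comp _ _).symm.trans congr(StrictHom.toPseudo $k₁)
  have hv : k' ≫ v = 𝟙 Z := (StrictHom.toPseudo_comp _ _).symm.trans congr(StrictHom.toPseudo $k₂)
  let cell : u ≫ z ≅ v := AlgTwoCell.isoMk (ArrowLimit.algCell L) (L.isIso_cell trivial)
  let Θ : δ ≫ z ≅ 𝟙 Z :=
    eqToIso (by rw [← hδ, Category.assoc]) ≪≫ whiskerLeftIso k' cell ≪≫ eqToIso hv
  have hΘ : z ◁ Θ.hom = eqToHom (by
      rw [← Category.assoc, show z ≫ δ = 𝟙 _ from tri, Category.id_comp, Category.comp_id]) := by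
    have h : (z ≫ k') ◁ cell.hom = eqToHom (by
        rw [← Category.assoc, show (z ≫ k') ≫ u = 𝟙 _ from h₁,
          show (z ≫ k') ≫ v = z from h₂, Category.id_comp]) := by
      apply AlgTwoCell.ext
      rw [AlgTwoCell.eqToHom_hom]
      exact hd
    simp [comp_eqToHom_iff, eqToHom_comp_iff] at h
    simp [Θ, h]
  exact ⟨Θ, tri, hΘ⟩

end PseudomorphismClassifier

/-! ### The comparison `Δ` is a surjective equivalence. -/

theorem exists_cell_freeLift {C : K} {Y : T.Alg} (g : T.obj C ⟶ Y.carrier)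
    (c : T.map g ≫ Y.str ≅ T.μ C ≫ g)
    (hu : T.η (T.obj C) ◁ c.hom = eqToHom (by exact unit_src (X := T.free C) g))
    (hm : T.map₂ c.hom ▷ Y.str ≫ eqToHom (by exact mult_mid (X := T.free C) g) ≫
      T.map (T.μ C) ◁ c.hom = eqToHom (by exact mult_src (X := T.free C) g) ≫
        T.μ (T.obj C) ◁ c.hom ≫ eqToHom (by exact (mult_tgt (X := T.free C) g).symm)) :
    ∃ γ : T.map (T.η C ≫ g) ≫ Y.str ≅ g,
      T.η C ◁ γ.hom = eqToHom (η_freeLift (T.η C ≫ g)) ∧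
      T.map₂ γ.hom ▷ Y.str ≫ c.hom =
        eqToHom (freeLift (T.η C ≫ g)).comm ≫ T.μ C ◁ γ.hom := by
  let γ : T.map (T.η C ≫ g) ≫ Y.str ≅ g :=
    eqToIso (by rw [T.map_comp, Category.assoc]) ≪≫ whiskerLeftIso (T.map (T.η C)) c ≪≫
      eqToIso (by rw [← Category.assoc, T.right_unit, Category.id_comp])
  refine ⟨γ, ?_, ?_⟩
  · simp [γ, η_whiskerLeft_map, hu]
  · have e₃ : T.map (T.map (T.η C)) ≫ T.map (T.μ C) = 𝟙 _ := by
      rw [← T.map_comp, T.right_unit, T.map_id]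
    have hc : c.hom = eqToHom (by rw [← Category.assoc, e₃, Category.id_comp]) ≫
        T.map (T.map (T.η C)) ◁ T.map (T.μ C) ◁ c.hom ≫
          eqToHom (by rw [← Category.assoc, e₃, Category.id_comp]) := by
      simp [whiskerLeft_whiskerLeft_of_eq_id e₃]
    replace hm := congr(T.map (T.map (T.η C)) ◁ $hm)
    rw [hc]
    simp at hm
    simp [γ, μ_whiskerLeft_map, reassoc_of% hm]

/-- Every pseudomorphism out of a free algebra is isomorphic to the strict morphism with the same
restriction along the unit. -/
theorem PseudoHom.exists_freeLift_cell {C : K} {Y : T.Alg} (g : PseudoHom (T.free C) Y) :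
    ∃ γ : AlgTwoCell (freeLift (T.η C ≫ g.hom)).toPseudo g, IsIso γ.hom ∧
      T.η C ◁ γ.hom = eqToHom (η_freeLift (T.η C ≫ g.hom)) := by
  obtain ⟨γ, h₁, h₂⟩ := exists_cell_freeLift g.hom g.cst g.unit g.mult
  exact ⟨⟨γ.hom, h₂⟩, inferInstanceAs (IsIso γ.hom), h₁⟩

namespace UniversalPseudomorphism

variable {C C' : K} {φ : C ⟶ C'} (V : T.UniversalPseudomorphism φ)

theorem κ_delta : V.κ ≫ V.delta.hom = T.η C' := V.κ_extend _ _

theorem hom_delta : V.hom.comp V.delta.toPseudo = (T.freeMap φ).toPseudo := V.hom_extend_η _ _ _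

/-- The section `S` extends `κ`. The pseudomorphism `V.hom` is isomorphic by `γ` to the strict map
`T φ ≫ S`, and `γ` is the identity on generators. Thus `γ` on `T C` and the identity of `κ` on `C'`
form a square over `φ` into the pseudolimit of an identity, and the induced strict `k` encodes an
isomorphism from `Δ ≫ S` to `1`. -/
theorem isSurjectiveEquivalence_delta
    (L : ArrowLimit True (PseudoHom.id V.obj).hom) :
    IsSurjectiveEquivalence (K := T.AlgS) (Y := ⟨T.free C'⟩) (Z := ⟨V.obj⟩) V.delta := by
  let S : StrictHom (T.free C') V.obj := freeLift V.κ
  have hS : T.η C' ≫ S.hom = V.κ := η_freeLift V.κ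
  have hφ : freeLift (T.η C ≫ V.hom.hom) = (T.freeMap φ).comp S := free_hom_ext (by
    rw [η_freeLift, V.comm, ← hS, ← Category.assoc, T.η_comm, Category.assoc])
  obtain ⟨γ, hγ, hη⟩ := V.hom.exists_freeLift_cell
  obtain ⟨z, h₁, h₂, hz⟩ := ArrowLimit.exists_idLift L γ (fun _ => hγ)
  obtain ⟨i, i₁, i₂, hi⟩ := L.exists_lift V.κ V.κ (eqToHom (Category.comp_id V.κ))
    (fun _ => inferInstance)
  -- The cells encoded by the two sides agree because `γ` restricts to an identity along `η`.
  have hi' : T.η C ≫ z.hom = φ ≫ i := by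
    have z₁ : z.hom ≫ L.fst = _ := congr(PseudoHom.hom $h₁)
    have z₂ : z.hom ≫ L.snd = _ := congr(PseudoHom.hom $h₂)
    refine L.hom_ext ?_ ?_ ?_
    · rw [Category.assoc, Category.assoc, i₁, z₁, ← V.comm]
      exact η_freeLift _
    · rw [Category.assoc, Category.assoc, i₂, z₂, V.comm]
    · have e₁ := congr(T.η C ◁ $hz)
      have e₂ := congr(φ ◁ $hi)
      simp [ArrowLimit.idCell, hη, eqToHom_comp_iff] at e₁
      simp at e₂
      simp [e₁, e₂]
  let k := V.extend z ⟨(T.η C, i), hi'⟩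
  have hk : V.hom.comp k.toPseudo = z := V.hom_extend_η z i hi'
  have hκ : V.κ ≫ k.hom = i := V.κ_extend _ _
  have k₁ : k.comp (ArrowLimit.algFst L) = V.delta.comp S := V.strict_ext (by
      rw [StrictHom.toPseudo_comp, StrictHom.toPseudo_comp, ← PseudoHom.assoc, ← PseudoHom.assoc,
        hk, h₁, hom_delta, hφ, StrictHom.toPseudo_comp]) (by
      change V.κ ≫ k.hom ≫ L.fst = V.κ ≫ V.delta.hom ≫ S.hom
      rw [← Category.assoc, hκ, i₁, ← Category.assoc, κ_delta, hS])
  have k₂ : k.comp (ArrowLimit.algSnd L) = StrictHom.id _ := V.strict_ext (by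
      rw [StrictHom.toPseudo_comp, ← PseudoHom.assoc, hk, h₂]
      exact V.hom.comp_id.symm) (by
      change V.κ ≫ k.hom ≫ L.snd = V.κ ≫ 𝟙 _
      rw [← Category.assoc, hκ, i₂, Category.comp_id])
  let X : T.AlgS := ⟨V.obj⟩
  let F : T.AlgS := ⟨T.free C'⟩
  let M : T.AlgS := ⟨ArrowLimit.alg L⟩
  let u : M ⟶ X := ArrowLimit.algFst L
  let v : M ⟶ X := ArrowLimit.algSnd L
  let k' : X ⟶ M := k
  let d : X ⟶ F := V.delta
  let S' : F ⟶ X := S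
  have hu : k' ≫ u = d ≫ S' := k₁
  have hv : k' ≫ v = 𝟙 X := k₂
  have hcell : IsIso L.cell := L.isIso_cell trivial
  let cell : u ≅ v := AlgTwoCell.isoMkStrict (ArrowLimit.idCell L)
    (inferInstanceAs (IsIso (eqToHom _ ≫ L.cell)))
  refine ⟨S', ?_, ⟨eqToIso hu.symm ≪≫ whiskerLeftIso k' cell ≪≫ eqToIso hv⟩⟩
  refine free_hom_ext ?_
  change T.η C' ≫ S.hom ≫ V.delta.hom = T.η C' ≫ 𝟙 _
  rw [← Category.assoc, hS, κ_delta, Category.comp_id]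

end UniversalPseudomorphism

end TwoMonad

end TwoDim

theorem mainTheorem1 {K : Type u} [Bicategory.{w, v} K] [Bicategory.Strict K]
    (T : TwoDim.TwoMonad K)
    (hyp1 : ∀ {A B : K} (f : A ⟶ B), Nonempty (TwoDim.Pseudolimit f))
    (hyp2a : ∀ X : K, Nonempty (TwoDim.Cotensor (Fin 2) X))
    (hyp2b : ∀ X : K, Nonempty (TwoDim.Cotensor WalkingIso.{0} X))
    (hyp3 : Limits.HasPushouts T.AlgS)
    (hyp4 : ∀ U : T.UniversalPseudomorphisms, U.HasCoequalizersOfPFreePairs) :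
    (Nonempty T.PseudomorphismClassifier ↔ Nonempty T.UniversalPseudomorphisms) ∧
    (∀ (c : T.PseudomorphismClassifier) (Y : T.AlgS),
      ∃ Θ, TwoDim.IsAdjointSurjectiveEquivalence
        (c.adj.unit (T.incl.obj Y)) (T.incl.map (c.adj.counit Y)) Θ) ∧
    (∀ (U : T.UniversalPseudomorphisms) {C C' : K} (φ : C ⟶ C'),
      TwoDim.IsSurjectiveEquivalence (K := T.AlgS)
        (Y := ⟨T.free C'⟩) (Z := ⟨(U.univ φ).obj⟩) (U.univ φ).delta) := by
  have : Limits.HasPushouts T.AlgS := hyp3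
  have hL {A B : K} (f : A ⟶ B) : Nonempty (TwoDim.ArrowLimit True f) :=
    (hyp1 f).map TwoDim.ArrowLimit.ofPseudolimit
  refine ⟨⟨fun ⟨c⟩ => ⟨⟨fun φ => (c.nonempty_universalPseudomorphism φ).some⟩⟩, fun ⟨U⟩ =>
    TwoDim.TwoMonad.nonempty_pseudomorphismClassifier
      (fun X => (hyp2a X).map TwoDim.ArrowLimit.ofCotensor)
      (U.exists_isClassifier (hyp4 U))⟩, fun c Y => ?_, fun U {C C'} φ => ?_⟩
  · exact (hL _).elim (c.exists_isAdjointSurjectiveEquivalence Y)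
  · exact (hL _).elim (U.univ φ).isSurjectiveEquivalence_delta
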